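/- Let $m\ge 0$ and $\alpha,\beta\in\mathbb{R}$, let $z\in C^1([0,\infty);\mathbb{R})$ and $\lambda\in C^1([0,\infty);\mathbb{C})$, and let $\Omega=\{(x,t): t\ge 0,\ x\ge z(t)\}$. Put $$N_1(u,v)=\alpha u|v|^2+2\beta v(\overline{u}v+u\overline{v}),\qquad N_2(u,v)=\alpha v|u|^2+2\beta u(\overline{u}v+u\overline{v}).$$ Consider, for complex-valued $u,v$ on $\Omega$, the initial boundary value problem $$i(u_t+u_x)=-mv+N_1(u,v),\qquad i(v_t-v_x)=-mu+N_2(u,v)\quad\text{in }\Omega,$$ $$u(x,0)=u_0(x),\quad v(x,0)=v_0(x)\quad (x\ge 0),\qquad u(z(t),t)=\lambda(t)\,v(z(t),t)\quad (t\ge 0).$$ Assume (H1) $z(0)=0$ and $-1<z_t(t)<1$ for all $t\ge 0$; (H2) $|\lambda(t)|^2(1-z_t(t))\le 1+z_t(t)$ for all $t\ge 0$. Let $u_0,v_0\in C^1([0,\infty);\mathbb{C})$ have compact support in $[0,\infty)$ and satisfy the compatibility conditions $u_0(0)=\lambda(0)v_0(0)$ and $$(1-z_t(0))u_{0x}(0)+\lambda(0)(1+z_t(0))v_{0x}(0)+i\lambda(0)\big(mu_0(0)-N_2(u_0(0),v_0(0))\big)-i\big(mv_0(0)-N_1(u_0(0),v_0(0))\big)+\lambda_t(0)v_0(0)=0,$$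 where derivatives at $0$ are one-sided. Then the initial boundary value problem has a unique global solution $(u,v)$ with $u,v\in C^1(\overline{\Omega})$, that is, continuously differentiable up to the boundary of $\Omega$. -/

import Mathlib

namespace DiracIBVP

/-- The space-time region `{(x, t) : t ≥ 0, x ≥ z(t)}`; points are written `(x, t)`. -/
def region (z : ℝ → ℝ) : Set (ℝ × ℝ) :=
  {p | 0 ≤ p.2 ∧ z p.2 ≤ p.1}

/-- `N₁(u, v) = α u |v|² + 2 β v (ū v + u v̄)`. -/
noncomputable def N₁ (α β : ℝ) (u v : ℂ) : ℂ :=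
  (α : ℂ) * u * ((‖v‖ ^ 2 : ℝ) : ℂ)
    + 2 * (β : ℂ) * v * (starRingEnd ℂ u * v + u * starRingEnd ℂ v)

/-- `N₂(u, v) = α v |u|² + 2 β u (ū v + u v̄)`. -/
noncomputable def N₂ (α β : ℝ) (u v : ℂ) : ℂ :=
  (α : ℂ) * v * ((‖u‖ ^ 2 : ℝ) : ℂ)
    + 2 * (β : ℂ) * u * (starRingEnd ℂ u * v + u * starRingEnd ℂ v)

/-- The time derivative `w_t` at `(x, t)`. -/
noncomputable def dt (w : ℝ × ℝ → ℂ) (x t : ℝ) : ℂ := deriv (fun s => w (x, s)) t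

/-- The space derivative `w_x` at `(x, t)`. -/
noncomputable def dx (w : ℝ × ℝ → ℂ) (x t : ℝ) : ℂ := deriv (fun y => w (y, t)) x

/-- The derivative on `[0, ∞)` (one-sided at `0`). -/
noncomputable def halfDeriv {E : Type*} [NormedAddCommGroup E] [NormedSpace ℝ E]
    (f : ℝ → E) (s : ℝ) : E := derivWithin f (Set.Ici 0) s

/-- `f` restricted to `[0, ∞)` has compact support. -/
def CompactSupportOnHalfLine (f : ℝ → ℂ) : Prop :=
  IsCompact (closure {x : ℝ | 0 ≤ x ∧ f x ≠ 0})

/-- `(u, v)` is a global classical solution of the initial boundary value problem: it is `C¹` on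
the closed region (`C¹` up to the boundary), solves the equations, and takes the initial and
boundary values. The equations are written at the interior points, where `w_t` and `w_x` are
two-sided derivatives; since the first derivatives are continuous up to the boundary, they then
hold on the whole closed region. -/
structure IsGlobalC1Solution (m α β : ℝ) (z : ℝ → ℝ) (lam u₀ v₀ : ℝ → ℂ)
    (u v : ℝ × ℝ → ℂ) : Prop where
  contDiffOn_u : ContDiffOn ℝ 1 u (region z)
  contDiffOn_v : ContDiffOn ℝ 1 v (region z)
  eq_u : ∀ x t : ℝ, 0 < t → z t < x →
    Complex.I * (dt u x t + dx u x t)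
      = -(m : ℂ) * v (x, t) + N₁ α β (u (x, t)) (v (x, t))
  eq_v : ∀ x t : ℝ, 0 < t → z t < x →
    Complex.I * (dt v x t - dx v x t)
      = -(m : ℂ) * u (x, t) + N₂ α β (u (x, t)) (v (x, t))
  initial_u : ∀ x : ℝ, 0 ≤ x → u (x, 0) = u₀ x
  initial_v : ∀ x : ℝ, 0 ≤ x → v (x, 0) = v₀ x
  boundary : ∀ t : ℝ, 0 ≤ t → u (z t, t) = lam t * v (z t, t)

end DiracIBVP

namespace DiracIBVP

open Set Filter Topology MeasureTheory intervalIntegral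
open scoped NNReal

/-! In the characteristic coordinates `ξ = x - t`, `η = x + t` the system reads `u_η = f(u, v)`,
`v_ξ = g(u, v)`. By (H1) the boundary becomes a decreasing curve `η = A ξ` over `ξ ≤ 0`, with `A' =
-(1 + z_t) / (1 - z_t)`. The component `v` is carried from the initial line `ξ = η` towards smaller
`ξ`. The component `u` is carried towards larger `η`, from the initial line if `ξ ≥ 0` and from the
boundary, where `u = μ v`, if `ξ ≤ 0`. Both equations can be integrated along characteristics on
compact domains that exhaust the region.

For Lipschitz `f`, `g` the integral equations have a unique continuous solution, by a contraction in
a norm weighted by `exp(K(η - ξ))` (`exists_unique_picard_fixedPoint`). Regularity uses that each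
integral equation already gives one derivative: `u` is differentiable in `η`, which is exactly the
parameter of the ODE for `v`, and conversely. Smooth dependence of ODEs on parameters
(`contDiff_ode_solution`) supplies the missing derivatives. The only obstruction is the
characteristic `ξ = 0` issuing from the corner, where the first-order compatibility condition makes
the two one-sided derivatives agree (`IsCharSolution.exists_contDiff_extension`).

The cubic terms are handled by a cutoff and an a priori bound independent of it. Since `Re(ū f) =
Re(v̄ g)` (`inner_charF`, `inner_charG`), the form `|u|² dξ + |v|² dη` is closed. Assumption (H2)
says `|μ|² ≤ -A'`, so the boundary feeds no charge into the domain, and the integrals of `|v|²`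
along `ξ = const` and of `|u|²` along `η = const` are bounded by the initial charge (`flux_bounds`).
Moreover `2|Re(ū f)| ≤ κ(1 + |u|²)(1 + |v|²)`: the rate of growth of `|u|²` is linear in `|v|²` and
vice versa, so Gronwall with an integrable rate bounds both pointwise (`exists_apriori_bound`). A
cutoff beyond that bound does not affect the solution.

Uniqueness on each domain follows in the same way, since two continuous solutions on a compact set
are unaffected by a large enough cutoff. Uniqueness lets the local solutions be glued
(`exists_isGlobalC1Solution_of_local`). -/

/-! ### Global solutions of Lipschitz ODEs, continuous in a parameter -/

theorem abs_integral_exp_le {K : ℝ} (hK : 0 < K) (a s : ℝ) :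
    |∫ σ in a..s, Real.exp (K * |σ - a|)| ≤ Real.exp (K * |s - a|) / K := by
  rcases le_total a s with h | h
  · have h1 : ∫ σ in a..s, Real.exp (K * |σ - a|)
        = Real.exp (K * (s - a)) / K - Real.exp (K * (a - a)) / K := by
      rw [integral_congr (g := fun σ => Real.exp (K * (σ - a)))]
      · refine integral_eq_sub_of_hasDerivAt
          (f := fun σ => Real.exp (K * (σ - a)) / K) (fun σ _ => ?_)
          (Continuous.intervalIntegrable (by fun_prop) _ _)
        have := ((((hasDerivAt_id σ).sub_const a).const_mul K).exp).div_const K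
        refine this.congr_deriv ?_
        simp only [id]; field_simp
      · intro σ hσ
        rw [uIcc_of_le h] at hσ
        beta_reduce
        rw [abs_of_nonneg (by linarith [hσ.1])]
    rw [h1, abs_of_nonneg (by linarith : 0 ≤ s - a), abs_of_nonneg]
    · simp only [sub_self, mul_zero, Real.exp_zero]
      have : 0 < 1 / K := by positivity
      linarith
    · rw [sub_nonneg]; gcongr
  · have h1 : ∫ σ in a..s, Real.exp (K * |σ - a|)
        = -Real.exp (K * (a - s)) / K - -Real.exp (K * (a - a)) / K := by
      rw [integral_congr (g := fun σ => Real.exp (K * (a - σ)))]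
      · refine integral_eq_sub_of_hasDerivAt
          (f := fun σ => -Real.exp (K * (a - σ)) / K) (fun σ _ => ?_)
          (Continuous.intervalIntegrable (by fun_prop) _ _)
        have := ((((hasDerivAt_id σ).const_sub a).const_mul K).exp).neg.div_const K
        refine this.congr_deriv ?_
        simp only [id]; field_simp
      · intro σ hσ
        rw [uIcc_of_ge h] at hσ
        beta_reduce
        rw [abs_of_nonpos (by linarith [hσ.2]), neg_sub]
    rw [h1, abs_of_nonpos (by linarith : s - a ≤ 0), neg_sub, abs_of_nonpos]
    · simp only [sub_self, mul_zero, Real.exp_zero, neg_div]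
      have : 0 < 1 / K := by positivity
      linarith
    · rw [sub_nonpos, neg_div, neg_div]
      gcongr

theorem continuous_integral_from_curve {E : Type*} [NormedAddCommGroup E] [NormedSpace ℝ E]
    {a : ℝ → ℝ} (ha : Continuous a) {h : ℝ → ℝ → E} (hh : Continuous fun p : ℝ × ℝ => h p.1 p.2) :
    Continuous fun p : ℝ × ℝ => ∫ σ in a p.1..p.2, h p.1 σ := by
  have h1 : ∀ p : ℝ × ℝ, ∫ σ in a p.1..p.2, h p.1 σ
      = (∫ σ in (0 : ℝ)..p.2, h p.1 σ) - ∫ σ in (0 : ℝ)..a p.1, h p.1 σ := by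
    intro p
    have hc : Continuous (h p.1) := hh.comp (by fun_prop : Continuous fun σ => (p.1, σ))
    rw [integral_interval_sub_left (hc.intervalIntegrable _ _) (hc.intervalIntegrable _ _)]
  simp only [h1]
  have hh' : Continuous (Function.uncurry fun (p : ℝ × ℝ) σ => h p.1 σ) :=
    hh.comp (by fun_prop : Continuous fun q : (ℝ × ℝ) × ℝ => (q.1.1, q.2))
  exact (continuous_parametric_intervalIntegral_of_continuous hh' continuous_snd).sub
    (continuous_parametric_intervalIntegral_of_continuous hh' (ha.comp continuous_fst))

/-- Global solvability of a family of Lipschitz ordinary differential equations, with joint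
continuity in the parameter and the time. -/
theorem exists_continuous_ode_solution {E : Type*} [NormedAddCommGroup E] [NormedSpace ℝ E]
    [CompleteSpace E] {H : ℝ → ℝ → E → E}
    (hH : Continuous fun p : ℝ × ℝ × E => H p.1 p.2.1 p.2.2) {L : ℝ≥0}
    (hL : ∀ x s, LipschitzWith L (H x s)) {a : ℝ → ℝ} (ha : Continuous a)
    {b : ℝ → E} (hb : Continuous b) :
    ∃ Y : ℝ → ℝ → E, Continuous (fun p : ℝ × ℝ => Y p.1 p.2) ∧ (∀ x, Y x (a x) = b x) ∧
      ∀ x s, HasDerivAt (Y x) (H x s (Y x s)) s := by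
  -- This choice gives `L / K ≤ 1 / 2`, the contraction factor.
  set K : ℝ := 2 * L + 1 with hK
  have hKpos : 0 < K := by positivity
  -- The factor `m` absorbs the first Picard iterate, which need not be bounded on the plane. It
  -- increases away from `σ = a x`, so it can be pulled out of integrals starting there.
  set m : ℝ × ℝ → ℝ := fun p => 1 + |∫ σ in a p.1..p.2, ‖H p.1 σ (b p.1)‖| with hm
  have hHb : Continuous fun p : ℝ × ℝ => H p.1 p.2 (b p.1) :=
    hH.comp (by fun_prop : Continuous fun p : ℝ × ℝ => (p.1, p.2, b p.1))
  have hmc : Continuous m := by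
    have := continuous_integral_from_curve ha (h := fun x σ => ‖H x σ (b x)‖) hHb.norm
    exact continuous_const.add this.abs
  have hm1 : ∀ p, 1 ≤ m p := fun p => by simp only [hm]; linarith [abs_nonneg (∫ σ in a p.1..p.2, ‖H p.1 σ (b p.1)‖)]
  have hmmono : ∀ x s σ, σ ∈ uIoc (a x) s → m (x, σ) ≤ m (x, s) := by
    intro x s σ hσ
    simp only [hm]
    gcongr 1 + ?_
    refine abs_integral_mono_interval ?_ (Eventually.of_forall fun _ => norm_nonneg _)
      ((hHb.norm.comp (by fun_prop : Continuous fun σ => (x, σ))).intervalIntegrable _ _)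
    rcases le_total (a x) s with h | h
    · rw [uIoc_of_le h] at hσ ⊢
      rw [uIoc_of_le hσ.1.le]
      exact Ioc_subset_Ioc_right hσ.2
    · rw [uIoc_of_ge h] at hσ ⊢
      rw [uIoc_of_ge hσ.2]
      exact Ioc_subset_Ioc_left hσ.1.le
  set ω : ℝ × ℝ → ℝ := fun p => m p * Real.exp (K * |p.2 - a p.1|) with hω
  have hωc : Continuous ω := by fun_prop
  have hωpos : ∀ p, 0 < ω p := fun p => mul_pos (by linarith [hm1 p]) (Real.exp_pos _)
  have hmω : ∀ p, m p ≤ ω p := fun p => by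
    have : 1 ≤ Real.exp (K * |p.2 - a p.1|) := Real.one_le_exp (by positivity)
    exact le_mul_of_one_le_right (by linarith [hm1 p]) this
  have hint : ∀ x s, |∫ σ in a x..s, ω (x, σ)| ≤ ω (x, s) / K := by
    intro x s
    have h1 : |∫ σ in a x..s, ω (x, σ)|
        ≤ |∫ σ in a x..s, m (x, s) * Real.exp (K * |σ - a x|)| := by
      rw [← Real.norm_eq_abs]
      refine norm_integral_le_abs_of_norm_le ?_ (Continuous.intervalIntegrable (by fun_prop) _ _)
      refine (ae_restrict_iff' measurableSet_uIoc).2 (Eventually.of_forall fun σ hσ => ?_)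
      rw [Real.norm_of_nonneg (hωpos _).le]
      simp only [hω]
      gcongr
      exact hmmono x s σ hσ
    refine h1.trans ?_
    rw [intervalIntegral.integral_const_mul, abs_mul, abs_of_nonneg (by linarith [hm1 (x, s)])]
    calc _ ≤ m (x, s) * (Real.exp (K * |s - a x|) / K) := by
          have := hm1 (x, s)
          gcongr
          exact abs_integral_exp_le hKpos _ _
      _ = _ := by simp only [hω]; ring
  -- The solution is sought as `Y = b + ω W` with `W` bounded and continuous in parameter and time
  -- together. One fixed point then solves all the equations and is jointly continuous.
  let W0 := BoundedContinuousFunction (ℝ × ℝ) E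
  have hcont : ∀ W : W0, Continuous fun p : ℝ × ℝ => H p.1 p.2 (b p.1 + ω p • W p) := fun W =>
    hH.comp (by fun_prop : Continuous fun p : ℝ × ℝ => (p.1, p.2, b p.1 + ω p • W p))
  have hcontI : ∀ W : W0, Continuous fun p : ℝ × ℝ =>
      (ω p)⁻¹ • ∫ σ in a p.1..p.2, H p.1 σ (b p.1 + ω (p.1, σ) • W (p.1, σ)) := fun W =>
    (hωc.inv₀ fun p => (hωpos p).ne').smul
      (continuous_integral_from_curve ha
        (h := fun x σ => H x σ (b x + ω (x, σ) • W (x, σ))) (hcont W))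
  have hii : ∀ (W : W0) x s t,
      IntervalIntegrable (fun σ => H x σ (b x + ω (x, σ) • W (x, σ))) volume s t := fun W x s t =>
    ((hcont W).comp (by fun_prop : Continuous fun σ => (x, σ))).intervalIntegrable _ _
  have hiib : ∀ x s t, IntervalIntegrable (fun σ => H x σ (b x)) volume s t := fun x s t =>
    (hHb.comp (by fun_prop : Continuous fun σ => (x, σ))).intervalIntegrable _ _
  have hest : ∀ (g : ℝ × ℝ → E) (x s C : ℝ), (∀ σ, ‖g (x, σ)‖ ≤ L * (ω (x, σ) * C)) →
      0 ≤ C → ‖∫ σ in a x..s, g (x, σ)‖ ≤ ω (x, s) * (1 / 2 * C) := by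
    intro g x s C hg hC
    have h1 : ‖∫ σ in a x..s, g (x, σ)‖ ≤ |∫ σ in a x..s, (L * C) * ω (x, σ)| := by
      refine norm_integral_le_abs_of_norm_le (Eventually.of_forall fun σ => ?_)
        (Continuous.intervalIntegrable (by fun_prop) _ _)
      refine (hg σ).trans (le_of_eq (by ring))
    refine h1.trans ?_
    rw [intervalIntegral.integral_const_mul, abs_mul, abs_of_nonneg (by positivity)]
    calc _ ≤ L * C * (ω (x, s) / K) := by gcongr; exact hint x s
      _ = (ω (x, s) * C) * (L / K) := by ring
      _ ≤ (ω (x, s) * C) * (1 / 2) := by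
          have := (hωpos (x, s)).le
          refine mul_le_mul_of_nonneg_left ?_ (by positivity)
          rw [div_le_div_iff₀ hKpos two_pos]
          rw [hK]; linarith
      _ = _ := by ring
  have hbdd : ∀ (W : W0) p,
      ‖(ω p)⁻¹ • ∫ σ in a p.1..p.2, H p.1 σ (b p.1 + ω (p.1, σ) • W (p.1, σ))‖ ≤ 1 + ‖W‖ := by
    rintro W ⟨x, s⟩
    rw [norm_smul, norm_inv, Real.norm_of_nonneg (hωpos _).le, inv_mul_le_iff₀ (hωpos _)]
    have hsplit : ∫ σ in a x..s, H x σ (b x + ω (x, σ) • W (x, σ))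
        = (∫ σ in a x..s, H x σ (b x))
          + ∫ σ in a x..s, (H x σ (b x + ω (x, σ) • W (x, σ)) - H x σ (b x)) := by
      rw [intervalIntegral.integral_sub (hii W x _ _) (hiib x _ _)]; abel
    simp only
    rw [hsplit]
    refine (norm_add_le _ _).trans ?_
    have h1 : ‖∫ σ in a x..s, H x σ (b x)‖ ≤ ω (x, s) := by
      refine le_trans ?_ (hmω (x, s))
      refine (norm_integral_le_abs_integral_norm).trans ?_
      simp only [hm]; linarith
    have h2 := hest (fun p => H p.1 p.2 (b p.1 + ω p • W p) - H p.1 p.2 (b p.1)) x s ‖W‖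
      (fun σ => by
        refine ((hL x σ).norm_sub_le _ _).trans ?_
        rw [add_sub_cancel_left, norm_smul, Real.norm_of_nonneg (hωpos _).le]
        have := (hωpos (x, σ)).le
        gcongr
        exact W.norm_coe_le_norm _) (norm_nonneg _)
    nlinarith [norm_nonneg W, hωpos (x, s), mul_nonneg (hωpos (x, s)).le (norm_nonneg W)]
  let T : W0 → W0 := fun W =>
    BoundedContinuousFunction.ofNormedAddCommGroup _ (hcontI W) _ (hbdd W)
  have hT : ∀ W p, T W p
      = (ω p)⁻¹ • ∫ σ in a p.1..p.2, H p.1 σ (b p.1 + ω (p.1, σ) • W (p.1, σ)) :=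
    fun _ _ => rfl
  have hcontr : ContractingWith (1 / 2 : ℝ≥0) T := by
    refine ⟨by rw [← NNReal.coe_lt_coe]; norm_num, LipschitzWith.of_dist_le_mul fun W W' => ?_⟩
    rw [BoundedContinuousFunction.dist_le (by positivity)]
    rintro ⟨x, s⟩
    rw [dist_eq_norm, hT, hT, ← smul_sub, norm_smul, norm_inv, Real.norm_of_nonneg (hωpos _).le,
      inv_mul_le_iff₀ (hωpos _), ← intervalIntegral.integral_sub (hii W x _ _) (hii W' x _ _)]
    have h2 := hest (fun p => H p.1 p.2 (b p.1 + ω p • W p) - H p.1 p.2 (b p.1 + ω p • W' p))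
      x s (dist W W') (fun σ => by
        refine ((hL x σ).norm_sub_le _ _).trans ?_
        rw [add_sub_add_left_eq_sub, ← smul_sub, norm_smul, Real.norm_of_nonneg (hωpos _).le]
        have := (hωpos (x, σ)).le
        gcongr
        rw [← dist_eq_norm]; exact BoundedContinuousFunction.dist_coe_le_dist _) dist_nonneg
    simpa using h2
  obtain ⟨W, hW⟩ : ∃ W, T W = W := ⟨_, hcontr.fixedPoint_isFixedPt⟩
  set Y : ℝ → ℝ → E := fun x s => b x + ω (x, s) • W (x, s) with hY
  have hYi : ∀ x s, Y x s = b x + ∫ σ in a x..s, H x σ (Y x σ) := by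
    intro x s
    simp only [hY]
    congr 1
    have := hT W (x, s)
    rw [hW] at this
    rw [this, smul_inv_smul₀ (hωpos _).ne']
  refine ⟨Y, by fun_prop, fun x => by rw [hYi]; simp, fun x s => ?_⟩
  have hc : Continuous fun σ => H x σ (Y x σ) :=
    (hcont W).comp (by fun_prop : Continuous fun σ => (x, σ))
  have : Y x = fun s => b x + ∫ σ in a x..s, H x σ (Y x σ) := funext (hYi x)
  have h := (hc.integral_hasStrictDerivAt (a x) s).hasDerivAt.const_add (b x)
  rwa [← this] at h

/-! ### Functions of two variables with continuous partial derivatives, and differentiation of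
integrals -/

section Partial

variable {E : Type*} [NormedAddCommGroup E] [NormedSpace ℝ E] {f f₁ f₂ : ℝ → ℝ → E}

theorem hasStrictFDerivAt_of_partials
    (h₁ : ∀ x y, HasDerivAt (fun x => f x y) (f₁ x y) x) (h₂ : ∀ x y, HasDerivAt (f x) (f₂ x y) y)
    (c₁ : Continuous fun p : ℝ × ℝ => f₁ p.1 p.2) (c₂ : Continuous fun p : ℝ × ℝ => f₂ p.1 p.2)
    (p : ℝ × ℝ) :
    HasStrictFDerivAt (fun p : ℝ × ℝ => f p.1 p.2)
      ((ContinuousLinearMap.toSpanSingleton ℝ (f₁ p.1 p.2)).coprod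
        (ContinuousLinearMap.toSpanSingleton ℝ (f₂ p.1 p.2))) p :=
  hasStrictFDerivAt_uncurry_coprod (f := f)
    (f₁ := fun x y => ContinuousLinearMap.toSpanSingleton ℝ (f₁ x y))
    (f₂ := fun x y => ContinuousLinearMap.toSpanSingleton ℝ (f₂ x y))
    (Eventually.of_forall fun q => (h₁ q.1 q.2).hasFDerivAt)
    (Eventually.of_forall fun q => (h₂ q.1 q.2).hasFDerivAt)
    ((ContinuousLinearMap.toSpanSingletonCLE (𝕜 := ℝ) (E := E)).continuous.comp c₁).continuousAt
    ((ContinuousLinearMap.toSpanSingletonCLE (𝕜 := ℝ) (E := E)).continuous.comp c₂).continuousAt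

theorem contDiff_one_of_partials
    (h₁ : ∀ x y, HasDerivAt (fun x => f x y) (f₁ x y) x) (h₂ : ∀ x y, HasDerivAt (f x) (f₂ x y) y)
    (c₁ : Continuous fun p : ℝ × ℝ => f₁ p.1 p.2) (c₂ : Continuous fun p : ℝ × ℝ => f₂ p.1 p.2) :
    ContDiff ℝ 1 (fun p : ℝ × ℝ => f p.1 p.2) := by
  rw [contDiff_one_iff_hasFDerivAt]
  refine ⟨_, ?_, fun p => (hasStrictFDerivAt_of_partials h₁ h₂ c₁ c₂ p).hasFDerivAt⟩
  refine Continuous.congr (f := fun p : ℝ × ℝ =>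
    (ContinuousLinearMap.toSpanSingletonCLE (𝕜 := ℝ) (E := E) (f₁ p.1 p.2)).comp
        (ContinuousLinearMap.fst ℝ ℝ ℝ)
      + (ContinuousLinearMap.toSpanSingletonCLE (𝕜 := ℝ) (E := E) (f₂ p.1 p.2)).comp
        (ContinuousLinearMap.snd ℝ ℝ ℝ)) ?_ ?_
  · exact ((((ContinuousLinearMap.toSpanSingletonCLE (𝕜 := ℝ) (E := E)).continuous.comp
      c₁).clm_comp continuous_const).add
      (((ContinuousLinearMap.toSpanSingletonCLE (𝕜 := ℝ) (E := E)).continuous.comp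
      c₂).clm_comp continuous_const))
  · intro p
    ext <;> simp

theorem hasDerivAt_along_curve_of_partials
    (h₁ : ∀ x y, HasDerivAt (fun x => f x y) (f₁ x y) x) (h₂ : ∀ x y, HasDerivAt (f x) (f₂ x y) y)
    (c₁ : Continuous fun p : ℝ × ℝ => f₁ p.1 p.2) (c₂ : Continuous fun p : ℝ × ℝ => f₂ p.1 p.2)
    {p q : ℝ → ℝ} {p' q' t : ℝ} (hp : HasDerivAt p p' t) (hq : HasDerivAt q q' t) :
    HasDerivAt (fun t => f (p t) (q t)) (p' • f₁ (p t) (q t) + q' • f₂ (p t) (q t)) t := by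
  have h := (hasStrictFDerivAt_of_partials h₁ h₂ c₁ c₂ (p t, q t)).hasFDerivAt.comp_hasDerivAt t
    (hp.prodMk hq)
  simpa [Function.comp_def] using h

end Partial

/-- Differentiation of a parametric integral with continuous parameter derivative. -/
theorem hasDerivAt_parametric_integral {E : Type*} [NormedAddCommGroup E] [NormedSpace ℝ E]
    {h h' : ℝ → ℝ → E}
    (hd : ∀ c s, HasDerivAt (fun c => h c s) (h' c s) c)
    (hc : Continuous fun p : ℝ × ℝ => h p.1 p.2) (hc' : Continuous fun p : ℝ × ℝ => h' p.1 p.2)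
    (a b c : ℝ) :
    HasDerivAt (fun c => ∫ s in a..b, h c s) (∫ s in a..b, h' c s) c := by
  obtain ⟨C, hC⟩ := ((isCompact_Icc (a := c - 1) (b := c + 1)).prod
    (isCompact_uIcc (a := a) (b := b))).exists_bound_of_continuousOn hc'.continuousOn
  have hcs : ∀ c, Continuous (h c) := fun c => hc.comp (by fun_prop : Continuous fun s => (c, s))
  have hcs' : ∀ c, Continuous (h' c) := fun c => hc'.comp (by fun_prop : Continuous fun s => (c, s))
  refine (hasDerivAt_integral_of_dominated_loc_of_deriv_le (bound := fun _ => C)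
    (Icc_mem_nhds (show c - 1 < c by linarith) (show c < c + 1 by linarith))
    (Eventually.of_forall fun c => (hcs c).aestronglyMeasurable)
    ((hcs c).intervalIntegrable _ _) (hcs' c).aestronglyMeasurable
    (Eventually.of_forall fun s hs x hx => hC (x, s) ⟨hx, uIoc_subset_uIcc hs⟩)
    (by simp) (Eventually.of_forall fun s _ x _ => hd x s)).2

/-- The Leibniz rule along a curve, for the integral `∫_p^q h(q, s) ds`. -/
theorem hasDerivAt_integral_along_curve {E : Type*} [NormedAddCommGroup E] [NormedSpace ℝ E]
    [CompleteSpace E] {h h' : ℝ → ℝ → E}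
    (hd : ∀ c s, HasDerivAt (fun c => h c s) (h' c s) c)
    (hc : Continuous fun p : ℝ × ℝ => h p.1 p.2) (hc' : Continuous fun p : ℝ × ℝ => h' p.1 p.2)
    {p q : ℝ → ℝ} {p' q' t : ℝ} (hp : HasDerivAt p p' t) (hq : HasDerivAt q q' t) :
    HasDerivAt (fun t => ∫ s in p t..q t, h (q t) s)
      (q' • h (q t) (q t) - p' • h (q t) (p t) + q' • ∫ s in p t..q t, h' (q t) s) t := by
  have hcs : ∀ c, Continuous (h c) := fun c => hc.comp (by fun_prop : Continuous fun s => (c, s))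
  have hcs' : ∀ c, Continuous (h' c) := fun c => hc'.comp (by fun_prop : Continuous fun s => (c, s))
  have key : ∀ {p : ℝ → ℝ} {p' : ℝ}, HasDerivAt p p' t →
      HasDerivAt (fun t => ∫ s in (0 : ℝ)..p t, h (q t) s)
        (q' • (∫ s in (0 : ℝ)..p t, h' (q t) s) + p' • h (q t) (p t)) t := fun hp =>
    hasDerivAt_along_curve_of_partials (f := fun c x => ∫ s in (0 : ℝ)..x, h c s)
      (f₁ := fun c x => ∫ s in (0 : ℝ)..x, h' c s) (f₂ := fun c x => h c x)
      (fun c x => hasDerivAt_parametric_integral hd hc hc' 0 x c)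
      (fun c x => ((hcs c).integral_hasStrictDerivAt 0 x).hasDerivAt)
      (continuous_integral_from_curve continuous_const hc') hc hq hp
  have h1 := (key hq).sub (key hp)
  have h2 : (fun t => ∫ s in p t..q t, h (q t) s)
      = (fun t => ∫ s in (0 : ℝ)..q t, h (q t) s) - fun t => ∫ s in (0 : ℝ)..p t, h (q t) s := by
    ext t
    simp only [Pi.sub_apply]
    rw [integral_interval_sub_left ((hcs _).intervalIntegrable _ _)
      ((hcs _).intervalIntegrable _ _)]
  rw [h2]
  refine h1.congr_deriv ?_
  rw [← integral_interval_sub_left ((hcs' (q t)).intervalIntegrable 0 (q t))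
      ((hcs' _).intervalIntegrable 0 (p t)), smul_sub]
  abel

/-! ### Differentiable dependence of ODE solutions on a parameter -/

/-- Continuous differentiability, in the parameter and the time, of the solutions of an ordinary
differential equation `Y' = F (Y, q)` with a parameter-dependent coefficient `q` and initial
curve `s = a p`. -/
theorem contDiff_ode_solution {G E : Type*} [NormedAddCommGroup E] [NormedSpace ℝ E]
    [CompleteSpace E] [NormedAddCommGroup G] [NormedSpace ℝ G] [CompleteSpace G]
    {F : E × G → E} (hF : ContDiff ℝ 1 F) {L : ℝ≥0} (hL : LipschitzWith L F)
    {q q' : ℝ → ℝ → G} (hq : Continuous fun p : ℝ × ℝ => q p.1 p.2)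
    (hq' : Continuous fun p : ℝ × ℝ => q' p.1 p.2)
    (hqq' : ∀ p s, HasDerivAt (fun p => q p s) (q' p s) p)
    {a : ℝ → ℝ} (ha : Continuous a) {b c : ℝ → E} (hb : Continuous b) (hc : Continuous c)
    {Y : ℝ → ℝ → E} (hY : Continuous fun p : ℝ × ℝ => Y p.1 p.2) (hYa : ∀ p, Y p (a p) = b p)
    (hYd : ∀ p s, HasDerivAt (Y p) (F (Y p s, q p s)) s)
    (hk : ∀ p₀, HasDerivAt (fun p => b p - Y p₀ (a p)) (c p₀) p₀) :
    ContDiff ℝ 1 (fun p : ℝ × ℝ => Y p.1 p.2) := by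
  have hDF : Continuous (fderiv ℝ F) := hF.continuous_fderiv one_ne_zero
  have hDFL : ∀ w, ‖fderiv ℝ F w‖ ≤ L := fun w => norm_fderiv_le_of_lipschitz ℝ hL
  have hFd : ∀ w, HasFDerivAt F (fderiv ℝ F w) w :=
    fun w => (hF.differentiable one_ne_zero w).hasFDerivAt
  -- the linearised equation
  have hlip : ∀ (M : E × G →L[ℝ] E) (w : G), ‖M‖ ≤ L → LipschitzWith L fun y => M (y, w) := by
    intro M w hM
    refine LipschitzWith.of_dist_le_mul fun y y' => ?_
    rw [dist_eq_norm, dist_eq_norm, ← map_sub]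
    refine (M.le_opNorm _).trans ?_
    gcongr
    simp
  obtain ⟨P, hPc, hPa, hPd⟩ := exists_continuous_ode_solution
    (H := fun p s y => fderiv ℝ F (Y p s, q p s) (y, q' p s)) (L := L)
    (by
      have h1 : Continuous fun w : ℝ × ℝ × E => fderiv ℝ F (Y w.1 w.2.1, q w.1 w.2.1) :=
        hDF.comp ((hY.comp (by fun_prop : Continuous fun w : ℝ × ℝ × E => (w.1, w.2.1))).prodMk
          (hq.comp (by fun_prop : Continuous fun w : ℝ × ℝ × E => (w.1, w.2.1))))
      exact h1.clm_apply ((by fun_prop : Continuous fun w : ℝ × ℝ × E => w.2.2).prodMk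
        (hq'.comp (by fun_prop : Continuous fun w : ℝ × ℝ × E => (w.1, w.2.1)))))
    (fun p s => hlip _ _ (hDFL _)) ha hc
  refine contDiff_one_of_partials (f := Y) (f₁ := P) (f₂ := fun p s => F (Y p s, q p s)) ?_ hYd hPc
    (hF.continuous.comp (hY.prodMk hq))
  intro p₀ s₀
  -- averaged derivatives along the segment from `p₀` to `p`
  let W : ℝ → ℝ → E × G := fun p s => (Y p s, q p s)
  have hW : Continuous fun p : ℝ × ℝ => W p.1 p.2 := hY.prodMk hq
  let M : ℝ → ℝ → (E × G →L[ℝ] E) := fun p s =>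
    ∫ θ in (0 : ℝ)..1, fderiv ℝ F (W p₀ s + θ • (W p s - W p₀ s))
  let Q : ℝ → ℝ → G := fun p s => ∫ θ in (0 : ℝ)..1, q' (p₀ + θ * (p - p₀)) s
  have hMint : Continuous fun w : (ℝ × ℝ) × ℝ =>
      fderiv ℝ F (W p₀ w.1.2 + w.2 • (W w.1.1 w.1.2 - W p₀ w.1.2)) := by
    have h1 : Continuous fun w : (ℝ × ℝ) × ℝ => W p₀ w.1.2 :=
      hW.comp (by fun_prop : Continuous fun w : (ℝ × ℝ) × ℝ => (p₀, w.1.2))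
    have h2 : Continuous fun w : (ℝ × ℝ) × ℝ => W w.1.1 w.1.2 :=
      hW.comp (by fun_prop : Continuous fun w : (ℝ × ℝ) × ℝ => (w.1.1, w.1.2))
    exact hDF.comp (h1.add (continuous_snd.smul (h2.sub h1)))
  have hM : Continuous fun p : ℝ × ℝ => M p.1 p.2 :=
    continuous_parametric_intervalIntegral_of_continuous'
      (f := fun (p : ℝ × ℝ) θ => fderiv ℝ F (W p₀ p.2 + θ • (W p.1 p.2 - W p₀ p.2))) hMint 0 1
  have hQint : Continuous fun w : (ℝ × ℝ) × ℝ => q' (p₀ + w.2 * (w.1.1 - p₀)) w.1.2 :=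
    hq'.comp (by fun_prop : Continuous fun w : (ℝ × ℝ) × ℝ => (p₀ + w.2 * (w.1.1 - p₀), w.1.2))
  have hQ : Continuous fun p : ℝ × ℝ => Q p.1 p.2 :=
    continuous_parametric_intervalIntegral_of_continuous'
      (f := fun (p : ℝ × ℝ) θ => q' (p₀ + θ * (p.1 - p₀)) p.2) hQint 0 1
  have hML : ∀ p s, ‖M p s‖ ≤ L := fun p s => by
    simpa using norm_integral_le_of_norm_le_const (a := (0 : ℝ)) (b := 1) (C := L)
      fun θ _ => hDFL (W p₀ s + θ • (W p s - W p₀ s))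
  have hMF : ∀ p s, M p s (W p s - W p₀ s) = F (W p s) - F (W p₀ s) := by
    intro p s
    have hcc : Continuous fun θ : ℝ => fderiv ℝ F (W p₀ s + θ • (W p s - W p₀ s)) :=
      hMint.comp (by fun_prop : Continuous fun θ : ℝ => ((p, s), θ))
    simp only [M]
    rw [ContinuousLinearMap.intervalIntegral_apply (hcc.intervalIntegrable _ _)]
    rw [integral_eq_sub_of_hasDerivAt (f := fun θ : ℝ => F (W p₀ s + θ • (W p s - W p₀ s)))]
    · simp
    · intro θ _
      have h1 : HasDerivAt (fun θ : ℝ => W p₀ s + θ • (W p s - W p₀ s)) (W p s - W p₀ s) θ := by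
        simpa using ((hasDerivAt_id θ).smul_const (W p s - W p₀ s)).const_add (W p₀ s)
      exact (hFd _).comp_hasDerivAt θ h1
    · exact (hcc.clm_apply continuous_const).intervalIntegrable _ _
  have hQq : ∀ p s, (p - p₀) • Q p s = q p s - q p₀ s := by
    intro p s
    have hcc : Continuous fun θ : ℝ => q' (p₀ + θ * (p - p₀)) s :=
      hQint.comp (by fun_prop : Continuous fun θ : ℝ => ((p, s), θ))
    simp only [Q]
    rw [← intervalIntegral.integral_smul,
      integral_eq_sub_of_hasDerivAt (f := fun θ : ℝ => q (p₀ + θ * (p - p₀)) s)]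
    · simp
    · intro θ _
      have h1 : HasDerivAt (fun θ : ℝ => p₀ + θ * (p - p₀)) (p - p₀) θ := by
        simpa using ((hasDerivAt_id θ).mul_const (p - p₀)).const_add p₀
      exact (hqq' _ s).scomp θ h1
    · exact (hcc.const_smul _).intervalIntegrable _ _
  -- This is the value of `Y p - Y p₀` at `s = a p`. Only `k` is assumed differentiable at `p₀`, not
  -- `a` or `b`: in the application both have a corner at `0`, and the corners cancel in `k`.
  set k : ℝ → E := fun p => b p - Y p₀ (a p) with hkdef
  have hkc : Continuous k :=
    hb.sub (hY.comp (by fun_prop : Continuous fun p => (p₀, a p)))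
  have hdk : Continuous (dslope k p₀) := by
    rw [← continuousOn_univ]
    exact (continuousOn_dslope univ_mem).2 ⟨hkc.continuousOn, (hk p₀).differentiableAt⟩
  -- The difference quotient of `Y` solves a linear ODE with the averaged coefficients `M`, `Q` and
  -- the quotient of `k` as initial value. All of these extend continuously to `p = p₀`, so `D` is
  -- the difference quotient continued across `p₀`; there it solves the linearised equation and
  -- equals `P p₀`.
  obtain ⟨D, hDc, hDa, hDd⟩ := exists_continuous_ode_solution
    (H := fun p s y => M p s (y, Q p s)) (L := L)
    ((hM.comp (by fun_prop : Continuous fun w : ℝ × ℝ × E => (w.1, w.2.1))).clm_apply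
      ((by fun_prop : Continuous fun w : ℝ × ℝ × E => w.2.2).prodMk
        (hQ.comp (by fun_prop : Continuous fun w : ℝ × ℝ × E => (w.1, w.2.1)))))
    (fun p s => hlip _ _ (hML p s)) ha hdk
  have hDY : ∀ p, (fun s => (p - p₀) • D p s) = fun s => Y p s - Y p₀ s := by
    intro p
    refine ODE_solution_unique_univ (v := fun s y => M p s (y, q p s - q p₀ s)) (K := L)
      (s := fun _ => univ) (t₀ := a p) (fun s => (hlip _ _ (hML p s)).lipschitzOnWith)
      (fun s => ⟨?_, mem_univ _⟩) (fun s => ⟨?_, mem_univ _⟩) ?_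
    · refine ((hDd p s).const_smul (p - p₀)).congr_deriv ?_
      rw [← map_smul, Prod.smul_mk, hQq]
    · refine ((hYd p s).sub (hYd p₀ s)).congr_deriv ?_
      exact (hMF p s).symm
    · have := sub_smul_dslope k p₀ p
      have h0 : k p₀ = 0 := by simp only [hkdef, hYa, sub_self]
      simp only [hDa]
      rw [this, h0, sub_zero, hkdef, hYa]
  have hDP : D p₀ = P p₀ := by
    refine ODE_solution_unique_univ (v := fun s y => M p₀ s (y, Q p₀ s)) (K := L)
      (s := fun _ => univ) (t₀ := a p₀) (fun s => (hlip _ _ (hML p₀ s)).lipschitzOnWith)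
      (fun s => ⟨hDd p₀ s, mem_univ _⟩) (fun s => ⟨?_, mem_univ _⟩) ?_
    · refine (hPd p₀ s).congr_deriv ?_
      simp [M, Q, W]
    · rw [hDa, hPa, dslope_same, (hk p₀).deriv]
  rw [hasDerivAt_iff_tendsto_slope]
  have h1 : Tendsto (fun p => D p s₀) (𝓝[≠] p₀) (𝓝 (P p₀ s₀)) := by
    rw [← hDP]
    exact ((hDc.comp (by fun_prop : Continuous fun p => (p, s₀))).tendsto p₀).mono_left
      nhdsWithin_le_nhds
  refine h1.congr' ?_
  filter_upwards [self_mem_nhdsWithin] with p hp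
  have := congrFun (hDY p) s₀
  beta_reduce at this
  rw [slope_def_module, ← this, inv_smul_smul₀ (sub_ne_zero.2 hp)]

/-! ### Weighted contractions, and the geometry of the characteristic domain -/

/-- A map on `C(S, E)` that halves the distance weighted by `exp θ` has a unique fixed point. -/
theorem exists_unique_fixedPoint_of_weighted_contraction {S E : Type*} [TopologicalSpace S]
    [CompactSpace S] [NormedAddCommGroup E] [NormedSpace ℝ E] [CompleteSpace E] (θ : C(S, ℝ))
    (Φ : C(S, E) → C(S, E))
    (h : ∀ w w' : C(S, E), ∀ C : ℝ, 0 ≤ C → (∀ p, ‖w p - w' p‖ ≤ C * Real.exp (θ p)) →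
      ∀ p, ‖Φ w p - Φ w' p‖ ≤ 1 / 2 * C * Real.exp (θ p)) :
    ∃! w, Φ w = w := by
  -- Conjugating by multiplication with `exp θ` turns the weighted distance into the uniform one, so
  -- the ordinary contraction principle applies.
  let e : C(S, E) → C(S, E) := fun w => ⟨fun p => Real.exp (θ p) • w p, by fun_prop⟩
  let d : C(S, E) → C(S, E) := fun w => ⟨fun p => Real.exp (-θ p) • w p, by fun_prop⟩
  have hde : ∀ w, d (e w) = w := fun w => by
    ext p; simp [d, e, smul_smul, ← Real.exp_add]
  have hed : ∀ w, e (d w) = w := fun w => by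
    ext p; simp [d, e, smul_smul, ← Real.exp_add]
  have hcontr : ContractingWith (1 / 2 : ℝ≥0) (fun W => d (Φ (e W))) := by
    refine ⟨by rw [← NNReal.coe_lt_coe]; norm_num, LipschitzWith.of_dist_le_mul fun W W' => ?_⟩
    rw [ContinuousMap.dist_le (by positivity)]
    intro p
    have h1 := h (e W) (e W') (dist W W') dist_nonneg (fun p => by
      simp only [e, ContinuousMap.coe_mk]
      rw [← smul_sub, norm_smul, Real.norm_of_nonneg (Real.exp_pos _).le, mul_comm, ← dist_eq_norm]
      gcongr
      exact ContinuousMap.dist_apply_le_dist p) p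
    simp only [d, ContinuousMap.coe_mk]
    rw [dist_eq_norm, ← smul_sub, norm_smul, Real.norm_of_nonneg (Real.exp_pos _).le]
    calc _ ≤ Real.exp (-θ p) * (1 / 2 * dist W W' * Real.exp (θ p)) := by gcongr
      _ = (Real.exp (-θ p) * Real.exp (θ p)) * (1 / 2 * dist W W') := by ring
      _ = _ := by rw [← Real.exp_add]; simp
  refine ⟨e (hcontr.fixedPoint _), ?_, fun w hw => ?_⟩
  · have h1 : d (Φ (e (hcontr.fixedPoint _))) = hcontr.fixedPoint _ := hcontr.fixedPoint_isFixedPt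
    beta_reduce
    conv_rhs => rw [← h1]
    rw [hed]
  · have h1 : d w = hcontr.fixedPoint _ := hcontr.fixedPoint_unique
      (show d (Φ (e (d w))) = d w by rw [hed, hw])
    rw [← h1, hed]

/-- The value of `η` at which the characteristic `ξ = const` enters the domain: through the initial
line for `ξ ≥ 0`, through the boundary curve `η = A ξ` for `ξ ≤ 0`. -/
noncomputable def entry (A : ℝ → ℝ) (ξ : ℝ) : ℝ := max ξ (A ξ)

/-- The domain `ξ ≥ Ξ`, `entry A ξ ≤ η ≤ R` in the characteristic coordinates
`ξ = x - t`, `η = x + t`. -/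
def charDomain (A : ℝ → ℝ) (Ξ R : ℝ) : Set (ℝ × ℝ) :=
  {p | Ξ ≤ p.1 ∧ entry A p.1 ≤ p.2 ∧ p.2 ≤ R}

/-- The value of `u` where the characteristic `ξ = const` enters the domain. -/
noncomputable def entryValue (u₀ μ : ℝ → ℂ) (A : ℝ → ℝ) (V : ℝ × ℝ → ℂ) (ξ : ℝ) : ℂ :=
  u₀ (max ξ 0) + μ (min ξ 0) * V (min ξ 0, A (min ξ 0)) - u₀ 0

/-- Admissible boundary curves in characteristic coordinates. -/
structure IsCharBoundary (A : ℝ → ℝ) (Ξ R : ℝ) : Prop where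
  cont : Continuous A
  anti : Antitone A
  zero : A 0 = 0
  nonpos : Ξ ≤ 0
  nonneg : 0 ≤ R
  le : A Ξ ≤ R

/-- The integrated form of the problem in characteristic coordinates. -/
structure IsCharSolution (f g : ℂ × ℂ → ℂ) (A : ℝ → ℝ) (Ξ R : ℝ) (μ u₀ v₀ : ℝ → ℂ)
    (U V : ℝ × ℝ → ℂ) : Prop where
  contU : ContinuousOn U (charDomain A Ξ R)
  contV : ContinuousOn V (charDomain A Ξ R)
  eqU : ∀ p ∈ charDomain A Ξ R, U p = entryValue u₀ μ A V p.1
    + ∫ s in entry A p.1..p.2, f (U (p.1, s), V (p.1, s))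
  eqV : ∀ p ∈ charDomain A Ξ R, V p = v₀ p.2 - ∫ s in p.1..p.2, g (U (s, p.2), V (s, p.2))

/-- A retraction of the plane onto `charDomain A Ξ R`. -/
noncomputable def charRetract (A : ℝ → ℝ) (Ξ R : ℝ) (p : ℝ × ℝ) : ℝ × ℝ :=
  (max Ξ (min p.1 R), max (entry A (max Ξ (min p.1 R))) (min p.2 R))

namespace IsCharBoundary

variable {A : ℝ → ℝ} {Ξ R : ℝ}

theorem continuous_entry (hA : IsCharBoundary A Ξ R) : Continuous (entry A) := continuous_id.max hA.cont

theorem entry_of_nonneg (hA : IsCharBoundary A Ξ R) {ξ : ℝ} (h : 0 ≤ ξ) : entry A ξ = ξ :=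
  max_eq_left (by linarith [hA.anti h, hA.zero])

theorem entry_of_nonpos (hA : IsCharBoundary A Ξ R) {ξ : ℝ} (h : ξ ≤ 0) : entry A ξ = A ξ :=
  max_eq_right (by linarith [hA.anti h, hA.zero])

theorem entry_nonneg (hA : IsCharBoundary A Ξ R) (ξ : ℝ) : 0 ≤ entry A ξ := by
  rcases le_total 0 ξ with h | h
  · rwa [hA.entry_of_nonneg h]
  · rw [hA.entry_of_nonpos h, ← hA.zero]; exact hA.anti h

theorem entry_le (hA : IsCharBoundary A Ξ R) {ξ : ℝ} (h : Ξ ≤ ξ) (h' : ξ ≤ R) : entry A ξ ≤ R :=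
  max_le h' ((hA.anti h).trans hA.le)

theorem entry_mem (hA : IsCharBoundary A Ξ R) {ξ : ℝ} (h : Ξ ≤ ξ) (h' : ξ ≤ R) : (ξ, entry A ξ) ∈ charDomain A Ξ R :=
  ⟨h, le_rfl, hA.entry_le h h'⟩

theorem le_of_mem (_ : IsCharBoundary A Ξ R) {p : ℝ × ℝ} (hp : p ∈ charDomain A Ξ R) : p.1 ≤ p.2 :=
  (le_max_left _ _).trans hp.2.1

theorem nonneg_of_mem (hA : IsCharBoundary A Ξ R) {p : ℝ × ℝ} (hp : p ∈ charDomain A Ξ R) : 0 ≤ p.2 :=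
  (hA.entry_nonneg _).trans hp.2.1

theorem curve_mem (hA : IsCharBoundary A Ξ R) {ξ : ℝ} (h : Ξ ≤ ξ) :
    (min ξ 0, A (min ξ 0)) ∈ charDomain A Ξ R := by
  have h1 : Ξ ≤ min ξ 0 := le_min h hA.nonpos
  have := hA.entry_mem h1 ((min_le_right _ _).trans hA.nonneg)
  rwa [hA.entry_of_nonpos (min_le_right _ _)] at this

/-- Because `A` is decreasing, the characteristic carrying `v` back to the initial line never leaves
the domain. -/
theorem mem_of_mem_left (hA : IsCharBoundary A Ξ R) {p : ℝ × ℝ} (hp : p ∈ charDomain A Ξ R)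
    {s : ℝ} (hs : s ∈ Icc p.1 p.2) : (s, p.2) ∈ charDomain A Ξ R :=
  ⟨hp.1.trans hs.1, max_le hs.2 ((hA.anti hs.1).trans ((le_max_right _ _).trans hp.2.1)), hp.2.2⟩

theorem mem_of_mem_below (_ : IsCharBoundary A Ξ R) {p : ℝ × ℝ} (hp : p ∈ charDomain A Ξ R) {s : ℝ}
    (hs : s ∈ Icc (entry A p.1) p.2) : (p.1, s) ∈ charDomain A Ξ R :=
  ⟨hp.1, hs.1, hs.2.trans hp.2.2⟩

theorem isCompact (hA : IsCharBoundary A Ξ R) : IsCompact (charDomain A Ξ R) := by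
  refine (isCompact_Icc (a := ((Ξ, 0) : ℝ × ℝ)) (b := (R, R))).of_isClosed_subset ?_ ?_
  · exact (isClosed_le continuous_const continuous_fst).inter
      ((isClosed_le (hA.continuous_entry.comp continuous_fst) continuous_snd).inter
        (isClosed_le continuous_snd continuous_const))
  · intro p hp
    exact ⟨⟨hp.1, hA.nonneg_of_mem hp⟩, ⟨(hA.le_of_mem hp).trans hp.2.2, hp.2.2⟩⟩

theorem continuous_retract (hA : IsCharBoundary A Ξ R) : Continuous (charRetract A Ξ R) := by
  have := hA.continuous_entry
  unfold charRetract
  fun_prop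

theorem retract_mem (hA : IsCharBoundary A Ξ R) (p : ℝ × ℝ) : charRetract A Ξ R p ∈ charDomain A Ξ R :=
  ⟨le_max_left _ _, le_max_left _ _, max_le (hA.entry_le (le_max_left _ _)
    (max_le (hA.nonpos.trans hA.nonneg) (min_le_right _ _))) (min_le_right _ _)⟩

theorem retract_eq (hA : IsCharBoundary A Ξ R) {p : ℝ × ℝ} (hp : p ∈ charDomain A Ξ R) : charRetract A Ξ R p = p := by
  have h1 : p.1 ≤ R := (hA.le_of_mem hp).trans hp.2.2
  have h2 : max Ξ (min p.1 R) = p.1 := by rw [min_eq_left h1, max_eq_right hp.1]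
  ext
  · exact h2
  · simp only [charRetract, h2]
    rw [min_eq_left hp.2.2, max_eq_right hp.2.1]

theorem continuous_comp_retract (hA : IsCharBoundary A Ξ R) {E : Type*} [TopologicalSpace E]
    {w : ℝ × ℝ → E}
    (hw : ContinuousOn w (charDomain A Ξ R)) : Continuous fun p => w (charRetract A Ξ R p) :=
  hw.comp_continuous hA.continuous_retract hA.retract_mem

end IsCharBoundary

theorem continuous_integral_to_diagonal {E : Type*} [NormedAddCommGroup E] [NormedSpace ℝ E]
    {h : ℝ × ℝ → E} (hh : Continuous h) :
    Continuous fun p : ℝ × ℝ => ∫ s in p.1..p.2, h (s, p.2) := by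
  have h1 := (continuous_integral_from_curve (a := id) continuous_id
    (h := fun x σ => h (σ, x)) (hh.comp continuous_swap)).comp continuous_swap
  refine h1.neg.congr fun p => ?_
  rw [integral_symm p.2 p.1]
  rfl

theorem continuous_integral_from_entry {E : Type*} [NormedAddCommGroup E] [NormedSpace ℝ E]
    {h : ℝ × ℝ → E} (hh : Continuous h) {a : ℝ → ℝ} (ha : Continuous a) :
    Continuous fun p : ℝ × ℝ => ∫ s in a p.1..p.2, h (p.1, s) :=
  continuous_integral_from_curve ha (h := fun x σ => h (x, σ)) hh

theorem continuous_entryValue {u₀ μ : ℝ → ℂ} {A : ℝ → ℝ} {V : ℝ × ℝ → ℂ} (hu : Continuous u₀)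
    (hμ : Continuous μ) (hA : Continuous A) (hV : Continuous V) :
    Continuous (entryValue u₀ μ A V) := by
  unfold entryValue
  fun_prop

/-! ### Picard iteration for Lipschitz nonlinearities -/

section FixedPoint

variable {f g : ℂ × ℂ → ℂ} {A : ℝ → ℝ} {Ξ R : ℝ} {μ u₀ v₀ : ℝ → ℂ}

/-- The `v`-component of the Picard map. -/
noncomputable def picardV (g : ℂ × ℂ → ℂ) (v₀ : ℝ → ℂ) (w : ℝ × ℝ → ℂ × ℂ) (p : ℝ × ℝ) : ℂ :=
  v₀ p.2 - ∫ s in p.1..p.2, g (w (s, p.2))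

/-- The `u`-component of the Picard map. -/
noncomputable def picardU (f g : ℂ × ℂ → ℂ) (A : ℝ → ℝ) (μ u₀ v₀ : ℝ → ℂ)
    (w : ℝ × ℝ → ℂ × ℂ) (p : ℝ × ℝ) : ℂ :=
  entryValue u₀ μ A (picardV g v₀ w) p.1 + ∫ s in entry A p.1..p.2, f (w (p.1, s))

theorem continuous_picardV (hg : Continuous g) (hv : Continuous v₀) {w : ℝ × ℝ → ℂ × ℂ}
    (hw : Continuous w) : Continuous (picardV g v₀ w) :=
  (hv.comp continuous_snd).sub (continuous_integral_to_diagonal (hg.comp hw))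

theorem continuous_picardU (hA : IsCharBoundary A Ξ R) (hf : Continuous f) (hg : Continuous g)
    (hμ : Continuous μ) (hu : Continuous u₀) (hv : Continuous v₀) {w : ℝ × ℝ → ℂ × ℂ}
    (hw : Continuous w) : Continuous (picardU f g A μ u₀ v₀ w) :=
  ((continuous_entryValue hu hμ hA.cont (continuous_picardV hg hv hw)).comp continuous_fst).add
    (continuous_integral_from_entry (hf.comp hw) hA.continuous_entry)

/-- The weight `exp(K(η - ξ))` is `exp(2Kt)`: it decays back along the characteristic to the initial
line, so integrating it gains a factor `1 / K`. -/
theorem norm_picardV_sub_le (hA : IsCharBoundary A Ξ R) {L : ℝ≥0} (hg : LipschitzWith L g)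
    {K C : ℝ} (hK : 0 < K) (hC : 0 ≤ C) {w w' : ℝ × ℝ → ℂ × ℂ} (hw : Continuous w)
    (hw' : Continuous w')
    (h : ∀ p ∈ charDomain A Ξ R, ‖w p - w' p‖ ≤ C * Real.exp (K * (p.2 - p.1)))
    {p : ℝ × ℝ} (hp : p ∈ charDomain A Ξ R) :
    ‖picardV g v₀ w p - picardV g v₀ w' p‖ ≤ L * C / K * Real.exp (K * (p.2 - p.1)) := by
  have hle := hA.le_of_mem hp
  have hi : ∀ {w : ℝ × ℝ → ℂ × ℂ}, Continuous w →
      IntervalIntegrable (fun s => g (w (s, p.2))) volume p.1 p.2 := fun hw =>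
    (hg.continuous.comp (hw.comp (by fun_prop : Continuous fun s => (s, p.2)))).intervalIntegrable
      _ _
  simp only [picardV]
  rw [sub_sub_sub_cancel_left, ← intervalIntegral.integral_sub (hi hw') (hi hw), integral_symm,
    norm_neg]
  have h1 : ‖∫ s in p.2..p.1, (g (w' (s, p.2)) - g (w (s, p.2)))‖
      ≤ |∫ s in p.2..p.1, L * C * Real.exp (K * |s - p.2|)| := by
    refine norm_integral_le_abs_of_norm_le ?_ (Continuous.intervalIntegrable (by fun_prop) _ _)
    refine (ae_restrict_iff' measurableSet_uIoc).2 (Eventually.of_forall fun s hs => ?_)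
    rw [uIoc_of_ge hle] at hs
    have h2 := h _ (hA.mem_of_mem_left hp ⟨hs.1.le, hs.2⟩)
    refine (hg.norm_sub_le _ _).trans ?_
    rw [norm_sub_rev, abs_of_nonpos (by linarith [hs.2]), neg_sub, mul_assoc]
    gcongr
  refine h1.trans ?_
  rw [intervalIntegral.integral_const_mul, abs_mul, abs_of_nonneg (by positivity)]
  calc _ ≤ L * C * (Real.exp (K * |p.1 - p.2|) / K) := by
        gcongr
        exact abs_integral_exp_le hK _ _
    _ = _ := by rw [abs_of_nonpos (by linarith)]; ring_nf

/-- The boundary term contains `picardV g v₀ w` rather than the second component of `w`, so it too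
carries the small factor `1 / K` and `μ` may be of any size. It is evaluated where the
characteristic enters, which is no later than `p`, so its weight is dominated by the weight at `p`.
-/
theorem norm_picardU_sub_le (hA : IsCharBoundary A Ξ R) {L : ℝ≥0} (hf : LipschitzWith L f)
    (hg : LipschitzWith L g) {Λ : ℝ} (hΛ : ∀ ξ ∈ Icc Ξ 0, ‖μ ξ‖ ≤ Λ)
    {K C : ℝ} (hK : 0 < K) (hC : 0 ≤ C) {w w' : ℝ × ℝ → ℂ × ℂ} (hw : Continuous w)
    (hw' : Continuous w')
    (h : ∀ p ∈ charDomain A Ξ R, ‖w p - w' p‖ ≤ C * Real.exp (K * (p.2 - p.1)))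
    {p : ℝ × ℝ} (hp : p ∈ charDomain A Ξ R) :
    ‖picardU f g A μ u₀ v₀ w p - picardU f g A μ u₀ v₀ w' p‖
      ≤ (1 + Λ) * (L * C / K) * Real.exp (K * (p.2 - p.1)) := by
  have hle := hA.le_of_mem hp
  have hi : ∀ {w : ℝ × ℝ → ℂ × ℂ}, Continuous w →
      IntervalIntegrable (fun s => f (w (p.1, s))) volume (entry A p.1) p.2 := fun hw =>
    (hf.continuous.comp (hw.comp (by fun_prop : Continuous fun s => (p.1, s)))).intervalIntegrable
      _ _
  have hΛ0 : 0 ≤ Λ := (norm_nonneg _).trans (hΛ 0 ⟨hA.nonpos, le_rfl⟩)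
  have hint : ‖∫ s in entry A p.1..p.2, (f (w (p.1, s)) - f (w' (p.1, s)))‖
      ≤ L * C / K * Real.exp (K * (p.2 - p.1)) := by
    have h1 : ‖∫ s in entry A p.1..p.2, (f (w (p.1, s)) - f (w' (p.1, s)))‖
        ≤ |∫ s in entry A p.1..p.2, L * C * Real.exp (K * (entry A p.1 - p.1))
            * Real.exp (K * |s - entry A p.1|)| := by
      refine norm_integral_le_abs_of_norm_le ?_ (Continuous.intervalIntegrable (by fun_prop) _ _)
      refine (ae_restrict_iff' measurableSet_uIoc).2 (Eventually.of_forall fun s hs => ?_)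
      rw [uIoc_of_le hp.2.1] at hs
      have h2 := h _ (hA.mem_of_mem_below hp ⟨hs.1.le, hs.2⟩)
      refine (hf.norm_sub_le _ _).trans ?_
      rw [abs_of_nonneg (by linarith [hs.1]), mul_assoc (_ * C), ← Real.exp_add, mul_assoc]
      refine mul_le_mul_of_nonneg_left (h2.trans (le_of_eq ?_)) (by positivity)
      ring_nf
    refine h1.trans ?_
    rw [intervalIntegral.integral_const_mul, abs_mul, abs_of_nonneg (by positivity)]
    calc _ ≤ L * C * Real.exp (K * (entry A p.1 - p.1))
            * (Real.exp (K * |p.2 - entry A p.1|) / K) := by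
          gcongr
          exact abs_integral_exp_le hK _ _
      _ = L * C / K * (Real.exp (K * (entry A p.1 - p.1))
            * Real.exp (K * (p.2 - entry A p.1))) := by
          rw [abs_of_nonneg (by linarith [hp.2.1])]; ring
      _ = _ := by rw [← Real.exp_add]; ring_nf
  have hbd : ‖entryValue u₀ μ A (picardV g v₀ w) p.1 - entryValue u₀ μ A (picardV g v₀ w') p.1‖
      ≤ Λ * (L * C / K * Real.exp (K * (p.2 - p.1))) := by
    simp only [entryValue]
    rw [sub_sub_sub_cancel_right, add_sub_add_left_eq_sub, ← mul_sub, norm_mul]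
    have h1 := norm_picardV_sub_le (v₀ := v₀) hA hg hK hC hw hw' h (hA.curve_mem hp.1)
    have h2 : A (min p.1 0) - min p.1 0 ≤ p.2 - p.1 := by
      rcases le_total p.1 0 with h0 | h0
      · rw [min_eq_left h0]
        have := hp.2.1
        rw [hA.entry_of_nonpos h0] at this
        linarith
      · rw [min_eq_right h0, hA.zero]; linarith
    refine mul_le_mul (hΛ _ ⟨le_min hp.1 hA.nonpos, min_le_right _ _⟩) (h1.trans ?_)
      (norm_nonneg _) hΛ0
    gcongr
  simp only [picardU]
  rw [add_sub_add_comm, ← intervalIntegral.integral_sub (hi hw) (hi hw')]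
  refine (norm_add_le _ _).trans ?_
  calc _ ≤ Λ * (L * C / K * Real.exp (K * (p.2 - p.1)))
        + L * C / K * Real.exp (K * (p.2 - p.1)) := add_le_add hbd hint
    _ = _ := by ring

/-- Picard's theorem for the integrated problem with Lipschitz nonlinearities. -/
theorem exists_unique_picard_fixedPoint (hA : IsCharBoundary A Ξ R) {L : ℝ≥0}
    (hf : LipschitzWith L f) (hg : LipschitzWith L g) (hμ : Continuous μ) (hu : Continuous u₀)
    (hv : Continuous v₀) :
    ∃! w : C(charDomain A Ξ R, ℂ × ℂ), ∀ p : charDomain A Ξ R,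
      w p = (picardU f g A μ u₀ v₀ (fun p => w ⟨charRetract A Ξ R p, hA.retract_mem p⟩) p,
        picardV g v₀ (fun p => w ⟨charRetract A Ξ R p, hA.retract_mem p⟩) p) := by
  have : CompactSpace (charDomain A Ξ R) := isCompact_iff_compactSpace.1 hA.isCompact
  obtain ⟨Λ, hΛ⟩ := (isCompact_Icc (a := Ξ) (b := 0)).exists_bound_of_continuousOn hμ.continuousOn
  have hΛ0 : 0 ≤ Λ := (norm_nonneg _).trans (hΛ 0 ⟨hA.nonpos, le_rfl⟩)
  -- Makes `(1 + Λ) L / K ≤ 1 / 2`, which serves both components.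
  set K : ℝ := 2 * (1 + Λ) * L + 1 with hK
  have hKpos : 0 < K := by positivity
  have hext : ∀ w : C(charDomain A Ξ R, ℂ × ℂ),
      Continuous fun p => w ⟨charRetract A Ξ R p, hA.retract_mem p⟩ := fun w =>
    w.continuous.comp (hA.continuous_retract.subtype_mk _)
  let Φ : C(charDomain A Ξ R, ℂ × ℂ) → C(charDomain A Ξ R, ℂ × ℂ) := fun w =>
    ⟨fun p => (picardU f g A μ u₀ v₀ (fun p => w ⟨charRetract A Ξ R p, hA.retract_mem p⟩) p,
      picardV g v₀ (fun p => w ⟨charRetract A Ξ R p, hA.retract_mem p⟩) p),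
      ((continuous_picardU hA hf.continuous hg.continuous hμ hu hv (hext w)).comp
        continuous_subtype_val).prodMk
      ((continuous_picardV hg.continuous hv (hext w)).comp continuous_subtype_val)⟩
  have key := exists_unique_fixedPoint_of_weighted_contraction
    (⟨fun p => K * (p.1.2 - p.1.1), by fun_prop⟩ : C(charDomain A Ξ R, ℝ)) Φ ?_
  · have : ∀ w, Φ w = w ↔ ∀ p : charDomain A Ξ R,
      w p = (picardU f g A μ u₀ v₀ (fun p => w ⟨charRetract A Ξ R p, hA.retract_mem p⟩) p,
        picardV g v₀ (fun p => w ⟨charRetract A Ξ R p, hA.retract_mem p⟩) p) := fun w =>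
      ⟨fun h p => (congrArg (fun w => w p) h).symm, fun h => ContinuousMap.ext fun p => (h p).symm⟩
    simpa only [this] using key
  · intro w w' C hC h p
    have h' : ∀ p ∈ charDomain A Ξ R, ‖w ⟨charRetract A Ξ R p, hA.retract_mem p⟩
        - w' ⟨charRetract A Ξ R p, hA.retract_mem p⟩‖ ≤ C * Real.exp (K * (p.2 - p.1)) := by
      intro p hp
      have := h ⟨p, hp⟩
      simp only [hA.retract_eq hp]
      exact this
    have hLK : (1 + Λ) * (L * C / K) ≤ 1 / 2 * C := by
      rw [mul_div_assoc', div_le_iff₀ hKpos, hK]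
      nlinarith
    have hLK' : L * C / K ≤ 1 / 2 * C :=
      (le_mul_of_one_le_left (by positivity) (by linarith)).trans hLK
    refine (Prod.norm_def _).trans_le (max_le ?_ ?_)
    · refine (norm_picardU_sub_le hA hf hg hΛ hKpos hC (hext w) (hext w') h' p.2).trans ?_
      exact mul_le_mul_of_nonneg_right hLK (Real.exp_pos _).le
    · refine (norm_picardV_sub_le hA hg hKpos hC (hext w) (hext w') h' p.2).trans ?_
      exact mul_le_mul_of_nonneg_right hLK' (Real.exp_pos _).le

/-- The segments of integration stay in the domain, where the retraction is the identity. At the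
entry point `V` may be replaced by its Picard expression, by the second equation. -/
theorem isCharSolution_iff_picard (hA : IsCharBoundary A Ξ R) {U V : ℝ × ℝ → ℂ}
    (hU : ContinuousOn U (charDomain A Ξ R)) (hV : ContinuousOn V (charDomain A Ξ R)) :
    IsCharSolution f g A Ξ R μ u₀ v₀ U V ↔ ∀ p ∈ charDomain A Ξ R,
      (U p, V p) = (picardU f g A μ u₀ v₀
        (fun p => (U (charRetract A Ξ R p), V (charRetract A Ξ R p))) p,
        picardV g v₀ (fun p => (U (charRetract A Ξ R p), V (charRetract A Ξ R p))) p) := by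
  have hVi : ∀ p ∈ charDomain A Ξ R,
      picardV g v₀ (fun p => (U (charRetract A Ξ R p), V (charRetract A Ξ R p))) p
        = v₀ p.2 - ∫ s in p.1..p.2, g (U (s, p.2), V (s, p.2)) := by
    intro p hp
    simp only [picardV]
    congr 1
    refine integral_congr fun s hs => ?_
    rw [uIcc_of_le (hA.le_of_mem hp)] at hs
    rw [hA.retract_eq (hA.mem_of_mem_left hp hs)]
  have hUi : ∀ p ∈ charDomain A Ξ R,
      ∫ s in entry A p.1..p.2, f (U (charRetract A Ξ R (p.1, s)), V (charRetract A Ξ R (p.1, s)))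
        = ∫ s in entry A p.1..p.2, f (U (p.1, s), V (p.1, s)) := by
    intro p hp
    refine integral_congr fun s hs => ?_
    rw [uIcc_of_le hp.2.1] at hs
    rw [hA.retract_eq (hA.mem_of_mem_below hp hs)]
  constructor
  · intro h p hp
    rw [Prod.mk.injEq, hVi p hp, ← h.eqV p hp]
    refine ⟨?_, rfl⟩
    rw [h.eqU p hp, picardU, hUi p hp, entryValue, entryValue, hVi _ (hA.curve_mem hp.1),
      ← h.eqV _ (hA.curve_mem hp.1)]
  · intro h
    have hVe : ∀ p ∈ charDomain A Ξ R, V p = _ := fun p hp => (Prod.mk.inj (h p hp)).2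
    refine ⟨hU, hV, fun p hp => ?_, fun p hp => (hVe p hp).trans (hVi p hp)⟩
    rw [(Prod.mk.inj (h p hp)).1, picardU, hUi p hp, entryValue, entryValue,
      ← hVe _ (hA.curve_mem hp.1)]

theorem exists_isCharSolution (hA : IsCharBoundary A Ξ R) {L : ℝ≥0}
    (hf : LipschitzWith L f) (hg : LipschitzWith L g) (hμ : Continuous μ) (hu : Continuous u₀)
    (hv : Continuous v₀) : ∃ U V, IsCharSolution f g A Ξ R μ u₀ v₀ U V := by
  obtain ⟨w, hw, -⟩ := exists_unique_picard_fixedPoint hA hf hg hμ hu hv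
  have hc : Continuous fun p => w ⟨charRetract A Ξ R p, hA.retract_mem p⟩ :=
    w.continuous.comp (hA.continuous_retract.subtype_mk _)
  refine ⟨fun p => (w ⟨charRetract A Ξ R p, hA.retract_mem p⟩).1,
    fun p => (w ⟨charRetract A Ξ R p, hA.retract_mem p⟩).2,
    (isCharSolution_iff_picard hA hc.fst.continuousOn hc.snd.continuousOn).2 ?_⟩
  intro p hp
  simpa only [hA.retract_eq hp, hA.retract_eq (hA.retract_mem _)] using hw ⟨p, hp⟩

theorem IsCharSolution.unique (hA : IsCharBoundary A Ξ R) {L : ℝ≥0}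
    (hf : LipschitzWith L f) (hg : LipschitzWith L g) (hμ : Continuous μ) (hu : Continuous u₀)
    (hv : Continuous v₀) {U V U' V' : ℝ × ℝ → ℂ} (h : IsCharSolution f g A Ξ R μ u₀ v₀ U V)
    (h' : IsCharSolution f g A Ξ R μ u₀ v₀ U' V') :
    EqOn U U' (charDomain A Ξ R) ∧ EqOn V V' (charDomain A Ξ R) := by
  have hfix := (exists_unique_picard_fixedPoint hA hf hg hμ hu hv).unique
    (y₁ := ⟨fun p => (U p, V p), h.contU.domRestrict.prodMk h.contV.domRestrict⟩)
    (y₂ := ⟨fun p => (U' p, V' p), h'.contU.domRestrict.prodMk h'.contV.domRestrict⟩)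
    (fun p => (isCharSolution_iff_picard hA h.contU h.contV).1 h p p.2)
    (fun p => (isCharSolution_iff_picard hA h'.contU h'.contV).1
      h' p p.2)
  have hp : ∀ p ∈ charDomain A Ξ R, (U p, V p) = (U' p, V' p) := fun p hp =>
    congrArg (fun w : C(charDomain A Ξ R, ℂ × ℂ) => w ⟨p, hp⟩) hfix
  exact ⟨fun p h => (Prod.mk.inj (hp p h)).1, fun p h => (Prod.mk.inj (hp p h)).2⟩

end FixedPoint

/-! ### Continuous differentiability across the characteristic from the corner -/

theorem hasDerivAt_of_glue_at_zero {E : Type*} [NormedAddCommGroup E] [NormedSpace ℝ E]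
    {k kr kl : ℝ → E} {c : E} {p : ℝ} (hr : ∀ x, 0 ≤ x → k x = kr x) (hl : ∀ x, x ≤ 0 → k x = kl x)
    (hdr : 0 ≤ p → HasDerivAt kr c p) (hdl : p ≤ 0 → HasDerivAt kl c p) : HasDerivAt k c p := by
  rcases lt_trichotomy p 0 with hp | rfl | hp
  · refine (hdl hp.le).congr_of_eventuallyEq ?_
    filter_upwards [Iio_mem_nhds hp] with x hx using hl x hx.le
  · rw [← hasDerivWithinAt_univ, ← Ici_union_Iic (a := (0 : ℝ))]
    exact ((hdr le_rfl).hasDerivWithinAt.congr (fun x hx => hr x hx) (hr 0 le_rfl)).union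
      ((hdl le_rfl).hasDerivWithinAt.congr (fun x hx => hl x hx) (hl 0 le_rfl))
  · refine (hdr hp.le).congr_of_eventuallyEq ?_
    filter_upwards [Ioi_mem_nhds hp] with x hx using hr x hx.le

section Regularity

variable {f g : ℂ × ℂ → ℂ} {A : ℝ → ℝ} {Ξ R : ℝ} {μ u₀ v₀ : ℝ → ℂ}

/-- This and its counterpart for `picardU` give each component a continuous derivative along its own
characteristics from mere continuity of `w`, on the whole plane. For the ODE of the other component
this is the derivative with respect to the parameter. -/
theorem hasDerivAt_picardV (hg : Continuous g) {w : ℝ × ℝ → ℂ × ℂ} (hw : Continuous w)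
    (ξ η : ℝ) : HasDerivAt (fun ξ => picardV g v₀ w (ξ, η)) (g (w (ξ, η))) ξ := by
  have hc : Continuous fun s => g (w (s, η)) := hg.comp (hw.comp (by fun_prop))
  have h := (hc.integral_hasStrictDerivAt η ξ).hasDerivAt.const_add (v₀ η)
  refine h.congr_of_eventuallyEq (Eventually.of_forall fun x => ?_)
  simp only [picardV]
  rw [integral_symm, sub_neg_eq_add]

theorem hasDerivAt_picardU (hf : Continuous f) {w : ℝ × ℝ → ℂ × ℂ} (hw : Continuous w)
    (ξ η : ℝ) : HasDerivAt (fun η => picardU f g A μ u₀ v₀ w (ξ, η)) (f (w (ξ, η))) η := by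
  have hc : Continuous fun s => f (w (ξ, s)) := hf.comp (hw.comp (by fun_prop))
  exact (hc.integral_hasStrictDerivAt (entry A ξ) η).hasDerivAt.const_add
    (entryValue u₀ μ A (picardV g v₀ w) ξ)

/-- First-order compatibility of the data at the corner, in characteristic coordinates. -/
def CharCompatible (f g : ℂ × ℂ → ℂ) (A : ℝ → ℝ) (μ u₀ v₀ : ℝ → ℂ) : Prop :=
  deriv u₀ 0 - f (u₀ 0, v₀ 0) = deriv μ 0 * v₀ 0
    + μ 0 * (g (u₀ 0, v₀ 0) + deriv A 0 * (deriv v₀ 0 - g (u₀ 0, v₀ 0)))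
    - deriv A 0 * f (u₀ 0, v₀ 0)

/-- The `v`-component of a solution of the integrated problem extends to a `C¹` function on the
plane. -/
theorem exists_contDiff_extension_V (hA : IsCharBoundary A Ξ R) {L : ℝ≥0}
    (hfc : Continuous f) (hg : LipschitzWith L g) (hgd : ContDiff ℝ 1 g)
    (hμ : Continuous μ) (hu : Continuous u₀) (hv : ContDiff ℝ 1 v₀)
    {w : ℝ × ℝ → ℂ × ℂ} (hw : Continuous w)
    (hfix : ∀ p ∈ charDomain A Ξ R, w p = (picardU f g A μ u₀ v₀ w p, picardV g v₀ w p)) :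
    ∃ v : ℝ → ℝ → ℂ, ContDiff ℝ 1 (fun p : ℝ × ℝ => v p.1 p.2) ∧ (∀ η, v η η = v₀ η) ∧
      (∀ ξ η, HasDerivAt (fun ξ => v ξ η) (g (picardU f g A μ u₀ v₀ w (ξ, η), v ξ η)) ξ) ∧
      ∀ p ∈ charDomain A Ξ R, v p.1 p.2 = picardV g v₀ w p := by
  have hUc : Continuous (picardU f g A μ u₀ v₀ w) :=
    continuous_picardU hA hfc hg.continuous hμ hu hv.continuous hw
  have hVc : Continuous (picardV g v₀ w) := continuous_picardV hg.continuous hv.continuous hw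
  have hlip : ∀ q, LipschitzWith L fun y => g (q, y) := fun q => by
    simpa [Function.comp_def] using hg.comp (LipschitzWith.prodMk_left q)
  -- The Picard expression for `v` cannot be differentiated in `η` directly, as `w` is only
  -- continuous. Instead `v` is recovered as the solution of `v_ξ = g(u, v)` with the coefficient
  -- `u` given by `picardU`, which is differentiable in the parameter `η`.
  obtain ⟨Y, hYc, hYa, hYd⟩ := exists_continuous_ode_solution
    (H := fun η s y => g (picardU f g A μ u₀ v₀ w (s, η), y)) (L := L)
    (hg.continuous.comp ((hUc.comp (by fun_prop)).prodMk (by fun_prop)))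
    (fun η s => hlip _) continuous_id hv.continuous
  have hYC : ContDiff ℝ 1 (fun p : ℝ × ℝ => Y p.1 p.2) := by
    refine contDiff_ode_solution (F := fun w => g (w.2, w.1))
      (hgd.comp (contDiff_snd.prodMk contDiff_fst)) (L := L)
      (q := fun η s => picardU f g A μ u₀ v₀ w (s, η)) (q' := fun η s => f (w (s, η)))
      (c := fun η => deriv v₀ η - g (picardU f g A μ u₀ v₀ w (η, η), v₀ η))
      ?_ (hUc.comp (by fun_prop)) (hfc.comp (hw.comp (by fun_prop)))
      (fun η s => hasDerivAt_picardU hfc hw s η) continuous_id hv.continuous ?_ hYc hYa hYd ?_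
    · have := hg.comp ((LipschitzWith.prod_snd (α := ℂ) (β := ℂ)).prodMk LipschitzWith.prod_fst)
      simpa [Function.comp_def] using this
    · exact (hv.continuous_deriv le_rfl).sub (hg.continuous.comp
        ((hUc.comp (by fun_prop : Continuous fun η : ℝ => (η, η))).prodMk hv.continuous))
    · intro η
      have h1 := (hv.differentiable one_ne_zero η).hasDerivAt.sub (hYd η η)
      have h2 : Y η η = v₀ η := hYa η
      rwa [h2] at h1
  refine ⟨fun ξ η => Y η ξ, hYC.comp (contDiff_snd.prodMk contDiff_fst), hYa,
    fun ξ η => hYd η ξ, fun p hp => ?_⟩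
  -- Inside the domain both functions solve the same Lipschitz ODE and agree at the right end `s =
  -- η`, on the initial line.
  have key : EqOn (Y p.2) (fun s => picardV g v₀ w (s, p.2)) (Icc p.1 p.2) := by
    refine ODE_solution_unique_of_mem_Icc_left (K := L)
      (v := fun s y => g (picardU f g A μ u₀ v₀ w (s, p.2), y)) (s := fun _ => univ)
      (fun s _ => (hlip _).lipschitzOnWith) ?_
      (fun s _ => (hYd p.2 s).hasDerivWithinAt) (fun _ _ => mem_univ _) ?_
      (fun s hs => ?_) (fun _ _ => mem_univ _) ?_
    · exact (hYc.comp (by fun_prop : Continuous fun s => (p.2, s))).continuousOn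
    · exact (hVc.comp (by fun_prop : Continuous fun s => (s, p.2))).continuousOn
    · have h1 := (hasDerivAt_picardV (v₀ := v₀) hg.continuous hw s p.2).hasDerivWithinAt (s := Iic s)
      rwa [hfix (s, p.2) (hA.mem_of_mem_left hp (Ioc_subset_Icc_self hs))] at h1
    · simpa [picardV] using hYa p.2
  exact key ⟨le_rfl, hA.le_of_mem hp⟩

/-- A solution of the integrated problem with compatible `C¹` data extends to a pair of `C¹`
functions on the plane. -/
theorem IsCharSolution.exists_contDiff_extension (hA : IsCharBoundary A Ξ R)
    (hAd : ContDiff ℝ 1 A) {L : ℝ≥0}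
    (hf : LipschitzWith L f) (hg : LipschitzWith L g) (hfd : ContDiff ℝ 1 f)
    (hgd : ContDiff ℝ 1 g) (hμ : ContDiff ℝ 1 μ) (hu : ContDiff ℝ 1 u₀) (hv : ContDiff ℝ 1 v₀)
    (hcomp₀ : u₀ 0 = μ 0 * v₀ 0) (hcomp₁ : CharCompatible f g A μ u₀ v₀)
    {U V : ℝ × ℝ → ℂ} (h : IsCharSolution f g A Ξ R μ u₀ v₀ U V) :
    ∃ u v : ℝ → ℝ → ℂ, ContDiff ℝ 1 (fun p : ℝ × ℝ => u p.1 p.2) ∧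
      ContDiff ℝ 1 (fun p : ℝ × ℝ => v p.1 p.2) ∧
      ∀ p ∈ charDomain A Ξ R, u p.1 p.2 = U p ∧ v p.1 p.2 = V p ∧
        HasDerivAt (u p.1) (f (u p.1 p.2, v p.1 p.2)) p.2 ∧
        HasDerivAt (fun ξ => v ξ p.2) (g (u p.1 p.2, v p.1 p.2)) p.1 := by
  set w : ℝ × ℝ → ℂ × ℂ := fun p => (U (charRetract A Ξ R p), V (charRetract A Ξ R p)) with hwdef
  have hw : Continuous w :=
    (hA.continuous_comp_retract h.contU).prodMk (hA.continuous_comp_retract h.contV)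
  have hpic := (isCharSolution_iff_picard hA h.contU h.contV).1 h
  have hfix : ∀ p ∈ charDomain A Ξ R,
      w p = (picardU f g A μ u₀ v₀ w p, picardV g v₀ w p) := fun p hp => by
    rw [← hpic p hp, hwdef]; simp only [hA.retract_eq hp]
  set Vt := picardV g v₀ w with hVt
  set Ut := picardU f g A μ u₀ v₀ w with hUt
  have hUV : ∀ p ∈ charDomain A Ξ R, Ut p = U p ∧ Vt p = V p := fun p hp =>
    ⟨(Prod.mk.inj (hpic p hp)).1.symm, (Prod.mk.inj (hpic p hp)).2.symm⟩
  have hVtc : Continuous Vt := continuous_picardV hg.continuous hv.continuous hw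
  have hUtc : Continuous Ut :=
    continuous_picardU hA hf.continuous hg.continuous hμ.continuous hu.continuous hv.continuous hw
  obtain ⟨v, hvC, hvdiag, hvd, hvS⟩ := exists_contDiff_extension_V hA hf.continuous hg hgd
    hμ.continuous hu.continuous hv hw hfix
  have hVdiag : ∀ η, Vt (η, η) = v₀ η := fun η => by simp [hVt, picardV]
  have hU00 : Ut (0, 0) = u₀ 0 := by
    simp only [hUt, picardU, entryValue]
    rw [hA.entry_of_nonneg le_rfl, max_self, min_self, hA.zero, ← hVt, hVdiag, ← hcomp₀]
    simp
  set b : ℝ → ℂ := entryValue u₀ μ A (fun p => v p.1 p.2) with hb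
  have hbc : Continuous b :=
    continuous_entryValue hu.continuous hμ.continuous hA.cont hvC.continuous
  set m : ℝ → ℂ := fun ξ => μ ξ * v ξ (A ξ) with hm
  have hmC : ContDiff ℝ 1 m := hμ.mul (hvC.comp (contDiff_id.prodMk hAd))
  -- `entryValue` adds the two branches, each frozen at its corner value on the wrong side of `0`,
  -- and subtracts `u₀ 0`. The zeroth-order compatibility condition makes this the correct value on
  -- the right branch.
  have hbr : ∀ x, 0 ≤ x → b x = u₀ x := fun x hx => by
    simp only [hb, entryValue]
    rw [max_eq_left hx, min_eq_right hx, hA.zero, hvdiag, ← hcomp₀]; ring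
  have hbl : ∀ x, x ≤ 0 → b x = m x := fun x hx => by
    simp only [hb, entryValue]
    rw [max_eq_right hx, min_eq_left hx]; ring
  have hlip : ∀ q, LipschitzWith L fun y => f (y, q) := fun q => by
    simpa [Function.comp_def] using hf.comp (LipschitzWith.prodMk_right q)
  obtain ⟨Y, hYc, hYa, hYd⟩ := exists_continuous_ode_solution
    (H := fun ξ s y => f (y, Vt (ξ, s))) (L := L)
    (hf.continuous.comp ((by fun_prop : Continuous fun p : ℝ × ℝ × ℂ => p.2.2).prodMk
      (hVtc.comp (by fun_prop))))
    (fun ξ s => hlip _) hA.continuous_entry hbc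
  -- `cr` and `cl` are the derivatives of the entry value minus a fixed trajectory along the entry
  -- curve, on the initial line and on the boundary.
  set cr : ℝ → ℂ := fun ξ => deriv u₀ ξ - f (u₀ ξ, Vt (ξ, ξ)) with hcr
  set cl : ℝ → ℂ := fun ξ => deriv m ξ - deriv A ξ • f (m ξ, Vt (ξ, A ξ)) with hcl
  have hcrc : Continuous cr := (hu.continuous_deriv le_rfl).sub
    (hf.continuous.comp (hu.continuous.prodMk (hVtc.comp (by fun_prop))))
  have hclc : Continuous cl := (hmC.continuous_deriv le_rfl).sub
    ((hAd.continuous_deriv le_rfl).smul (hf.continuous.comp (hmC.continuous.prodMk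
      (hVtc.comp (continuous_id.prodMk hA.cont)))))
  have hm0 : m 0 = u₀ 0 := by rw [← hbl 0 le_rfl, hbr 0 le_rfl]
  have hmd : deriv m 0 = deriv μ 0 * v₀ 0
      + μ 0 * (g (u₀ 0, v₀ 0) + deriv A 0 * (deriv v₀ 0 - g (u₀ 0, v₀ 0))) := by
    have hD := (hvC.differentiable one_ne_zero (0, 0)).hasFDerivAt
    set D := fderiv ℝ (fun p : ℝ × ℝ => v p.1 p.2) (0, 0)
    have hchain : ∀ {p q : ℝ → ℝ} {p' q' : ℝ}, HasDerivAt p p' 0 → HasDerivAt q q' 0 → p 0 = 0 →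
        q 0 = 0 → HasDerivAt (fun t => v (p t) (q t)) (D (p', q')) 0 := fun hp hq hp0 hq0 =>
      hD.comp_hasDerivAt_of_eq (0 : ℝ) (hp.prodMk hq) (by rw [hp0, hq0])
    have h1 : D (1, 0) = g (u₀ 0, v₀ 0) := by
      have e1 : HasDerivAt (fun ξ => v ξ 0) (D (1, 0)) 0 :=
        hchain (hasDerivAt_id _) (hasDerivAt_const _ _) rfl rfl
      have e2 := hvd 0 0
      rw [← hUt, hU00, hvdiag] at e2
      exact e1.unique e2
    -- The equation gives `v_ξ = g` at the corner and the initial data give the derivative along the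
    -- diagonal; together they determine `v_η = v₀' - g`.
    have h2 : D (1, 1) = deriv v₀ 0 := by
      have e1 : HasDerivAt (fun ξ => v ξ ξ) (D (1, 1)) 0 :=
        hchain (hasDerivAt_id _) (hasDerivAt_id _) rfl rfl
      simp only [hvdiag] at e1
      exact e1.deriv.symm
    have hAd0 : HasDerivAt A (deriv A 0) 0 := (hAd.differentiable one_ne_zero 0).hasDerivAt
    have h3 : HasDerivAt (fun ξ => v ξ (A ξ)) (D (1, deriv A 0)) 0 :=
      hchain (hasDerivAt_id _) hAd0 rfl hA.zero
    have h4 : D (1, deriv A 0) = g (u₀ 0, v₀ 0)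
        + deriv A 0 * (deriv v₀ 0 - g (u₀ 0, v₀ 0)) := by
      have e1 : ((1, deriv A 0) : ℝ × ℝ) = (1, 0) + deriv A 0 • ((1, 1) - (1, 0)) := by
        simp
      rw [e1, map_add, map_smul, map_sub, h1, h2, Complex.real_smul]
    have h5 := (hμ.differentiable one_ne_zero 0).hasDerivAt.mul h3
    rw [hA.zero, hvdiag, h4] at h5
    exact h5.deriv
  -- This equality is exactly the first-order compatibility condition.
  have hc0 : cr 0 = cl 0 := by
    simp only [hcr, hcl]
    rw [hA.zero, hVdiag, hm0, hmd, Complex.real_smul]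
    exact hcomp₁
  have hYC : ContDiff ℝ 1 (fun p : ℝ × ℝ => Y p.1 p.2) := by
    refine contDiff_ode_solution (F := f) hfd hf
      (q := fun ξ s => Vt (ξ, s)) (q' := fun ξ s => g (w (ξ, s)))
      -- A case-free gluing of the two branches, continuous by construction; it has the right value
      -- for `ξ ≤ 0` because `cr 0 = cl 0`.
      (c := fun ξ => cr (max ξ 0) + cl (min ξ 0) - cl 0)
      (hVtc.comp (by fun_prop)) (hg.continuous.comp (hw.comp (by fun_prop)))
      (fun ξ s => hasDerivAt_picardV hg.continuous hw ξ s) hA.continuous_entry hbc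
      (by fun_prop) hYc hYa hYd ?_
    intro ξ
    refine hasDerivAt_of_glue_at_zero (kr := fun p => u₀ p - Y ξ p)
      (kl := fun p => m p - Y ξ (A p)) (fun x hx => ?_) (fun x hx => ?_) (fun hξ => ?_)
      (fun hξ => ?_)
    · rw [hbr x hx, hA.entry_of_nonneg hx]
    · rw [hbl x hx, hA.entry_of_nonpos hx]
    · have h1 := (hu.differentiable one_ne_zero ξ).hasDerivAt.sub (hYd ξ ξ)
      have h2 : Y ξ ξ = u₀ ξ := by
        have := hYa ξ
        rwa [hA.entry_of_nonneg hξ, hbr ξ hξ] at this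
      refine h1.congr_deriv ?_
      rw [h2, max_eq_left hξ, min_eq_right hξ, add_sub_cancel_right]
    · have h1 := (hmC.differentiable one_ne_zero ξ).hasDerivAt.sub
        ((hYd ξ (A ξ)).scomp ξ (hAd.differentiable one_ne_zero ξ).hasDerivAt)
      have h2 : Y ξ (A ξ) = m ξ := by
        have := hYa ξ
        rwa [hA.entry_of_nonpos hξ, hbl ξ hξ] at this
      refine h1.congr_deriv ?_
      rw [h2, max_eq_right hξ, min_eq_left hξ, hc0, add_sub_cancel_left]
  have hYS : ∀ p ∈ charDomain A Ξ R, Y p.1 p.2 = Ut p := by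
    intro p hp
    have key : EqOn (Y p.1) (fun s => Ut (p.1, s)) (Icc (entry A p.1) p.2) := by
      refine ODE_solution_unique_of_mem_Icc_right (K := L)
        (v := fun s y => f (y, Vt (p.1, s))) (s := fun _ => univ)
        (fun s _ => (hlip _).lipschitzOnWith) ?_
        (fun s _ => (hYd p.1 s).hasDerivWithinAt) (fun _ _ => mem_univ _) ?_
        (fun s hs => ?_) (fun _ _ => mem_univ _) ?_
      · exact (hYc.comp (by fun_prop : Continuous fun s => (p.1, s))).continuousOn
      · exact (hUtc.comp (by fun_prop : Continuous fun s => (p.1, s))).continuousOn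
      · have h1 := (hasDerivAt_picardU (g := g) (A := A) (μ := μ) (u₀ := u₀) (v₀ := v₀)
          hf.continuous hw p.1 s).hasDerivWithinAt (s := Ici s)
        rwa [hfix (p.1, s) (hA.mem_of_mem_below hp (Ico_subset_Icc_self hs))] at h1
      · rw [hYa]
        simp only [hb, hUt, picardU, integral_same, add_zero, entryValue]
        rw [hvS _ (hA.curve_mem hp.1)]
    exact key ⟨hp.2.1, le_rfl⟩
  refine ⟨Y, v, hYC, hvC, fun p hp => ⟨(hYS p hp).trans (hUV p hp).1,
    (hvS p hp).trans (hUV p hp).2, ?_, ?_⟩⟩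
  · rw [hvS p hp]; exact hYd p.1 p.2
  · rw [hYS p hp]; exact hvd p.1 p.2

end Regularity

/-- A `C¹` solution of the problem in characteristic coordinates. -/
structure IsClassicalCharSolution (f g : ℂ × ℂ → ℂ) (A : ℝ → ℝ) (Ξ R : ℝ) (μ u₀ v₀ : ℝ → ℂ)
    (u v : ℝ → ℝ → ℂ) : Prop where
  contDiff_u : ContDiff ℝ 1 (fun p : ℝ × ℝ => u p.1 p.2)
  contDiff_v : ContDiff ℝ 1 (fun p : ℝ × ℝ => v p.1 p.2)
  eq_u : ∀ p ∈ charDomain A Ξ R, HasDerivAt (u p.1) (f (u p.1 p.2, v p.1 p.2)) p.2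
  eq_v : ∀ p ∈ charDomain A Ξ R, HasDerivAt (fun ξ => v ξ p.2) (g (u p.1 p.2, v p.1 p.2)) p.1
  diag_u : ∀ ξ ∈ Icc 0 R, u ξ ξ = u₀ ξ
  diag_v : ∀ ξ ∈ Icc 0 R, v ξ ξ = v₀ ξ
  boundary : ∀ ξ ∈ Icc Ξ 0, u ξ (A ξ) = μ ξ * v ξ (A ξ)

theorem exists_isClassicalCharSolution_of_lipschitz {f g : ℂ × ℂ → ℂ} {A : ℝ → ℝ} {Ξ R : ℝ}
    {μ u₀ v₀ : ℝ → ℂ} (hA : IsCharBoundary A Ξ R)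
    (hAd : ContDiff ℝ 1 A) {L : ℝ≥0}
    (hf : LipschitzWith L f) (hg : LipschitzWith L g) (hfd : ContDiff ℝ 1 f)
    (hgd : ContDiff ℝ 1 g) (hμ : ContDiff ℝ 1 μ) (hu : ContDiff ℝ 1 u₀) (hv : ContDiff ℝ 1 v₀)
    (hcomp₀ : u₀ 0 = μ 0 * v₀ 0) (hcomp₁ : CharCompatible f g A μ u₀ v₀) :
    ∃ u v, IsClassicalCharSolution f g A Ξ R μ u₀ v₀ u v := by
  obtain ⟨U, V, h⟩ := exists_isCharSolution hA hf hg hμ.continuous hu.continuous hv.continuous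
  obtain ⟨u, v, huC, hvC, H⟩ :=
    h.exists_contDiff_extension hA hAd hf hg hfd hgd hμ hu hv hcomp₀ hcomp₁
  have hdiag : ∀ ξ ∈ Icc 0 R, (ξ, ξ) ∈ charDomain A Ξ R := fun ξ hξ => by
    have := hA.entry_mem (hA.nonpos.trans hξ.1) hξ.2
    rwa [hA.entry_of_nonneg hξ.1] at this
  have hdv : ∀ ξ ∈ Icc 0 R, V (ξ, ξ) = v₀ ξ := fun ξ hξ => by
    rw [h.eqV _ (hdiag ξ hξ)]; simp
  have hV0 : V (0, 0) = v₀ 0 := hdv 0 ⟨le_rfl, hA.nonneg⟩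
  refine ⟨u, v, huC, hvC, fun p hp => (H p hp).2.2.1, fun p hp => (H p hp).2.2.2,
    fun ξ hξ => ?_, fun ξ hξ => ?_, fun ξ hξ => ?_⟩
  · rw [(H _ (hdiag ξ hξ)).1, h.eqU _ (hdiag ξ hξ), hA.entry_of_nonneg hξ.1, integral_same,
      entryValue, max_eq_left hξ.1, min_eq_right hξ.1, hA.zero, hV0, ← hcomp₀]
    ring
  · rw [(H _ (hdiag ξ hξ)).2.1, hdv ξ hξ]
  · have hm := hA.entry_mem hξ.1 (hξ.2.trans hA.nonneg)
    have he := hA.entry_of_nonpos hξ.2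
    rw [he] at hm
    rw [(H _ hm).1, (H _ hm).2.1, h.eqU _ hm, he, integral_same, entryValue,
      max_eq_right hξ.2, min_eq_left hξ.2]
    ring

/-! ### Gronwall inequalities, conservation of charge and the a priori bound -/

theorem le_mul_exp_of_deriv_le {y y' k : ℝ → ℝ} {a b : ℝ} (hab : a ≤ b)
    (hy : ∀ t ∈ Icc a b, HasDerivAt y (y' t) t) (hk : Continuous k)
    (h : ∀ t ∈ Icc a b, y' t ≤ k t * y t) : y b ≤ y a * Real.exp (∫ t in a..b, k t) := by
  have hd : ∀ t ∈ Icc a b, HasDerivAt (fun t => y t * Real.exp (-∫ s in a..t, k s))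
      ((y' t - k t * y t) * Real.exp (-∫ s in a..t, k s)) t := fun t ht => by
    have := (hy t ht).mul ((hk.integral_hasStrictDerivAt a t).hasDerivAt.neg.exp)
    refine this.congr_deriv ?_
    simp only [Pi.neg_apply]; ring
  have hanti : AntitoneOn (fun t => y t * Real.exp (-∫ s in a..t, k s)) (Icc a b) := by
    refine antitoneOn_of_deriv_nonpos (convex_Icc a b)
      (fun t ht => (hd t ht).continuousAt.continuousWithinAt)
      (fun t ht => (hd t (interior_subset ht)).differentiableAt.differentiableWithinAt)
      (fun t ht => ?_)
    rw [(hd t (interior_subset ht)).deriv]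
    exact mul_nonpos_of_nonpos_of_nonneg (sub_nonpos.2 (h t (interior_subset ht)))
      (Real.exp_pos _).le
  have := hanti (left_mem_Icc.2 hab) (right_mem_Icc.2 hab) hab
  simp only [integral_same, neg_zero, Real.exp_zero, mul_one] at this
  rwa [Real.exp_neg, mul_inv_le_iff₀ (Real.exp_pos _)] at this

/-- Gronwall run backwards, for `v`, which propagates in the direction of decreasing `ξ`. -/
theorem le_mul_exp_of_neg_le_deriv {y y' k : ℝ → ℝ} {a b : ℝ} (hab : a ≤ b)
    (hy : ∀ t ∈ Icc a b, HasDerivAt y (y' t) t) (hk : Continuous k)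
    (h : ∀ t ∈ Icc a b, -(k t * y t) ≤ y' t) : y a ≤ y b * Real.exp (∫ t in a..b, k t) := by
  have h1 := le_mul_exp_of_deriv_le (y := fun t => y (-t)) (y' := fun t => -y' (-t))
    (k := fun t => k (-t)) (neg_le_neg hab)
    (fun t ht => by
      have := (hy (-t) ⟨by linarith [ht.2], by linarith [ht.1]⟩).scomp t (hasDerivAt_neg t)
      simpa [Function.comp_def] using this)
    (hk.comp continuous_neg)
    (fun t ht => by
      have := h (-t) ⟨by linarith [ht.2], by linarith [ht.1]⟩
      linarith)
  simpa using h1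

section APriori

variable {f g : ℂ × ℂ → ℂ} {A : ℝ → ℝ} {Ξ R : ℝ} {μ u₀ v₀ : ℝ → ℂ} {u v : ℝ → ℝ → ℂ}

/-- The potential of the closed form `|u|² dξ + |v|² dη` expressing conservation of charge. -/
noncomputable def chargePotential (u₀ v₀ : ℝ → ℂ) (u : ℝ → ℝ → ℂ) (ξ η : ℝ) : ℝ :=
  (∫ s in (0 : ℝ)..η, (‖u₀ s‖ ^ 2 + ‖v₀ s‖ ^ 2)) - ∫ s in ξ..η, ‖u s η‖ ^ 2

/-- Charge conservation gives `∂_η |u|² = ∂_ξ |v|²`, so the integral term of the Leibniz rule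
becomes a difference of boundary values of `|v|²`. The values on the diagonal cancel against the
derivative of the initial charge. -/
theorem IsClassicalCharSolution.hasDerivAt_chargePotential (hA : IsCharBoundary A Ξ R)
    (h : IsClassicalCharSolution f g A Ξ R μ u₀ v₀ u v)
    (hg : Continuous g) (hu : Continuous u₀) (hv : Continuous v₀)
    (hfg : ∀ w : ℂ × ℂ, inner ℝ w.1 (f w) = inner ℝ w.2 (g w))
    {p q : ℝ → ℝ} {p' q' t : ℝ} (hp : HasDerivAt p p' t) (hq : HasDerivAt q q' t)
    (hpq : (p t, q t) ∈ charDomain A Ξ R) :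
    HasDerivAt (fun t => chargePotential u₀ v₀ u (p t) (q t))
      (p' * ‖u (p t) (q t)‖ ^ 2 + q' * ‖v (p t) (q t)‖ ^ 2) t := by
  have hle := hA.le_of_mem hpq
  have hq0 := hA.nonneg_of_mem hpq
  have huc := h.contDiff_u.continuous
  have hvc := h.contDiff_v.continuous
  have hud : ∀ ξ η, HasDerivAt (u ξ)
      (fderiv ℝ (fun p : ℝ × ℝ => u p.1 p.2) (ξ, η) (0, 1)) η := fun ξ η =>
    ((h.contDiff_u.differentiable one_ne_zero (ξ, η)).hasFDerivAt).comp_hasDerivAt η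
      ((hasDerivAt_const η ξ).prodMk (hasDerivAt_id η))
  have hudc : Continuous fun p : ℝ × ℝ =>
      fderiv ℝ (fun p : ℝ × ℝ => u p.1 p.2) p (0, 1) :=
    (h.contDiff_u.continuous_fderiv one_ne_zero).clm_apply continuous_const
  have hQ : HasDerivAt (fun t => ∫ s in (0 : ℝ)..q t, (‖u₀ s‖ ^ 2 + ‖v₀ s‖ ^ 2))
      (q' * (‖u₀ (q t)‖ ^ 2 + ‖v₀ (q t)‖ ^ 2)) t :=
    (((show Continuous fun s => ‖u₀ s‖ ^ 2 + ‖v₀ s‖ ^ 2 by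
      fun_prop).integral_hasStrictDerivAt 0 (q t)).hasDerivAt).scomp t hq
  have hJ := hasDerivAt_integral_along_curve (h := fun c s => ‖u s c‖ ^ 2)
    (h' := fun c s => 2 * inner ℝ (u s c) (fderiv ℝ (fun p : ℝ × ℝ => u p.1 p.2) (s, c) (0, 1)))
    (fun c s => (hud s c).norm_sq)
    ((huc.comp continuous_swap).norm.pow 2)
    (continuous_const.mul ((huc.comp continuous_swap).inner (hudc.comp continuous_swap))) hp hq
  have hint : ∫ s in p t..q t,
      2 * inner ℝ (u s (q t)) (fderiv ℝ (fun p : ℝ × ℝ => u p.1 p.2) (s, q t) (0, 1))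
        = ‖v (q t) (q t)‖ ^ 2 - ‖v (p t) (q t)‖ ^ 2 := by
    have hcg : Continuous fun s => g (u s (q t), v s (q t)) :=
      hg.comp ((huc.comp (by fun_prop : Continuous fun s => (s, q t))).prodMk
        (hvc.comp (by fun_prop : Continuous fun s => (s, q t))))
    rw [← integral_eq_sub_of_hasDerivAt (f := fun s => ‖v s (q t)‖ ^ 2)
      (f' := fun s => 2 * inner ℝ (v s (q t)) (g (u s (q t), v s (q t))))]
    · refine integral_congr fun s hs => ?_
      rw [uIcc_of_le hle] at hs
      have hm := hA.mem_of_mem_left hpq hs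
      have := (hud s (q t)).unique (h.eq_u _ hm)
      rw [this]
      exact congrArg (2 * ·) (hfg (u s (q t), v s (q t)))
    · intro s hs
      rw [uIcc_of_le hle] at hs
      exact (h.eq_v _ (hA.mem_of_mem_left hpq hs)).norm_sq
    · exact (continuous_const.mul ((hvc.comp
        (by fun_prop : Continuous fun s => (s, q t))).inner hcg)).intervalIntegrable _ _
  refine (hQ.sub hJ).congr_deriv ?_
  rw [hint, h.diag_u _ ⟨hq0, hpq.2.2⟩, h.diag_v _ ⟨hq0, hpq.2.2⟩]
  simp only [smul_eq_mul]
  ring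

theorem chargePotential_le (hu : Continuous u₀) (hv : Continuous v₀) {ξ η : ℝ} (h : ξ ≤ η)
    (hη : η ≤ R) (h0 : 0 ≤ η) :
    chargePotential u₀ v₀ u ξ η ≤ ∫ s in (0 : ℝ)..R, (‖u₀ s‖ ^ 2 + ‖v₀ s‖ ^ 2) := by
  have h1 : 0 ≤ ∫ s in ξ..η, ‖u s η‖ ^ 2 := integral_nonneg h fun _ _ => by positivity
  have h2 : ∫ s in (0 : ℝ)..η, (‖u₀ s‖ ^ 2 + ‖v₀ s‖ ^ 2)
      ≤ ∫ s in (0 : ℝ)..R, (‖u₀ s‖ ^ 2 + ‖v₀ s‖ ^ 2) :=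
    integral_mono_interval le_rfl h0 hη (Eventually.of_forall fun _ => by positivity)
      (Continuous.intervalIntegrable (by fun_prop) _ _)
  unfold chargePotential
  linarith

/-- Along the boundary the potential has derivative `(|μ|² + A')|v|² ≤ 0` in `ξ` and it vanishes at
the corner, so it is nonnegative for `ξ ≤ 0`. This is where (H2) acts. -/
theorem IsClassicalCharSolution.chargePotential_entry_nonneg (hA : IsCharBoundary A Ξ R)
    (hAd : ContDiff ℝ 1 A)
    (h : IsClassicalCharSolution f g A Ξ R μ u₀ v₀ u v)
    (hg : Continuous g) (hu : Continuous u₀) (hv : Continuous v₀)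
    (hfg : ∀ w : ℂ × ℂ, inner ℝ w.1 (f w) = inner ℝ w.2 (g w))
    (hμA : ∀ ξ ∈ Icc Ξ 0, ‖μ ξ‖ ^ 2 ≤ -deriv A ξ) {ξ : ℝ} (h1 : Ξ ≤ ξ) :
    0 ≤ chargePotential u₀ v₀ u ξ (entry A ξ) := by
  rcases le_total 0 ξ with h0 | h0
  · rw [hA.entry_of_nonneg h0]
    simp only [chargePotential, integral_same, sub_zero]
    exact integral_nonneg h0 fun _ _ => by positivity
  · rw [hA.entry_of_nonpos h0]
    have hd : ∀ t ∈ Icc Ξ 0, HasDerivAt (fun t => chargePotential u₀ v₀ u t (A t))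
        (1 * ‖u t (A t)‖ ^ 2 + deriv A t * ‖v t (A t)‖ ^ 2) t := fun t ht => by
      refine h.hasDerivAt_chargePotential hA hg hu hv hfg (p := id) (q := A) (hasDerivAt_id t)
        (hAd.differentiable one_ne_zero t).hasDerivAt ?_
      have := hA.entry_mem ht.1 (ht.2.trans hA.nonneg)
      rwa [hA.entry_of_nonpos ht.2] at this
    have hanti : AntitoneOn (fun t => chargePotential u₀ v₀ u t (A t)) (Icc Ξ 0) := by
      refine antitoneOn_of_deriv_nonpos (convex_Icc _ _)
        (fun t ht => (hd t ht).continuousAt.continuousWithinAt)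
        (fun t ht => (hd t (interior_subset ht)).differentiableAt.differentiableWithinAt)
        (fun t ht => ?_)
      have ht' := interior_subset ht
      rw [(hd t ht').deriv, h.boundary t ht', norm_mul]
      have := mul_le_mul_of_nonneg_right (hμA t ht') (sq_nonneg ‖v t (A t)‖)
      nlinarith
    have := hanti ⟨h1, h0⟩ ⟨hA.nonpos, le_rfl⟩ h0
    simpa [hA.zero, chargePotential] using this

/-- The first flux is the increment of the potential from the entry point, where it is nonnegative,
to `p`, where it is at most the initial charge. The second is the initial charge on `[0, η]` minus
the potential at `p`, and that potential is nonnegative because it grows from the entry point. -/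
theorem IsClassicalCharSolution.flux_bounds (hA : IsCharBoundary A Ξ R)
    (hAd : ContDiff ℝ 1 A)
    (h : IsClassicalCharSolution f g A Ξ R μ u₀ v₀ u v)
    (hg : Continuous g) (hu : Continuous u₀) (hv : Continuous v₀)
    (hfg : ∀ w : ℂ × ℂ, inner ℝ w.1 (f w) = inner ℝ w.2 (g w))
    (hμA : ∀ ξ ∈ Icc Ξ 0, ‖μ ξ‖ ^ 2 ≤ -deriv A ξ) {p : ℝ × ℝ} (hp : p ∈ charDomain A Ξ R) :
    (∫ s in entry A p.1..p.2, ‖v p.1 s‖ ^ 2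
        ≤ ∫ s in (0 : ℝ)..R, (‖u₀ s‖ ^ 2 + ‖v₀ s‖ ^ 2)) ∧
      ∫ s in p.1..p.2, ‖u s p.2‖ ^ 2 ≤ ∫ s in (0 : ℝ)..R, (‖u₀ s‖ ^ 2 + ‖v₀ s‖ ^ 2) := by
  have hle := hA.le_of_mem hp
  have h0 := hA.nonneg_of_mem hp
  have hvc := h.contDiff_v.continuous
  have hvi : ∫ s in entry A p.1..p.2, ‖v p.1 s‖ ^ 2
      = chargePotential u₀ v₀ u p.1 p.2 - chargePotential u₀ v₀ u p.1 (entry A p.1) := by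
    refine integral_eq_sub_of_hasDerivAt (f := fun s => chargePotential u₀ v₀ u p.1 s)
      (fun s hs => ?_) ?_
    · rw [uIcc_of_le hp.2.1] at hs
      have := h.hasDerivAt_chargePotential hA hg hu hv hfg (p := fun _ => p.1) (q := id)
        (hasDerivAt_const s p.1) (hasDerivAt_id s) (hA.mem_of_mem_below hp hs)
      simpa using this
    · exact ((hvc.comp (by fun_prop : Continuous fun s => (p.1, s))).norm.pow 2).intervalIntegrable
        _ _
  have hen := h.chargePotential_entry_nonneg hA hAd hg hu hv hfg hμA hp.1
  have hup := chargePotential_le (u := u) hu hv hle hp.2.2 h0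
  refine ⟨by linarith, ?_⟩
  have hvn : 0 ≤ ∫ s in entry A p.1..p.2, ‖v p.1 s‖ ^ 2 :=
    integral_nonneg hp.2.1 fun _ _ => by positivity
  have h2 : ∫ s in (0 : ℝ)..p.2, (‖u₀ s‖ ^ 2 + ‖v₀ s‖ ^ 2)
      ≤ ∫ s in (0 : ℝ)..R, (‖u₀ s‖ ^ 2 + ‖v₀ s‖ ^ 2) :=
    integral_mono_interval le_rfl h0 hp.2.2 (Eventually.of_forall fun _ => by positivity)
      (Continuous.intervalIntegrable (by fun_prop) _ _)
  have h3 : chargePotential u₀ v₀ u p.1 p.2 = (∫ s in (0 : ℝ)..p.2, (‖u₀ s‖ ^ 2 + ‖v₀ s‖ ^ 2))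
    - ∫ s in p.1..p.2, ‖u s p.2‖ ^ 2 := rfl
  linarith

/-- The a priori bound: it does not depend on the nonlinearity except through `κ`. -/
theorem exists_apriori_bound (hA : IsCharBoundary A Ξ R) (hAd : ContDiff ℝ 1 A)
    (hμ : Continuous μ) (hu : Continuous u₀) (hv : Continuous v₀)
    (hμA : ∀ ξ ∈ Icc Ξ 0, ‖μ ξ‖ ^ 2 ≤ -deriv A ξ) {κ : ℝ} (hκ : 0 ≤ κ) :
    ∃ M : ℝ, ∀ (f g : ℂ × ℂ → ℂ) (u v : ℝ → ℝ → ℂ), Continuous g →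
      (∀ w : ℂ × ℂ, inner ℝ w.1 (f w) = inner ℝ w.2 (g w)) →
      (∀ w : ℂ × ℂ, 2 * |inner ℝ w.1 (f w)| ≤ κ * (1 + ‖w.1‖ ^ 2) * (1 + ‖w.2‖ ^ 2)) →
      IsClassicalCharSolution f g A Ξ R μ u₀ v₀ u v →
      ∀ p ∈ charDomain A Ξ R, ‖(u p.1 p.2, v p.1 p.2)‖ ≤ M := by
  obtain ⟨B, hB⟩ := (isCompact_Icc (a := (0 : ℝ)) (b := R)).exists_bound_of_continuousOn
    (hu.prodMk hv).continuousOn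
  obtain ⟨Λ, hΛ⟩ := (isCompact_Icc (a := Ξ) (b := 0)).exists_bound_of_continuousOn hμ.continuousOn
  set Q : ℝ := ∫ s in (0 : ℝ)..R, (‖u₀ s‖ ^ 2 + ‖v₀ s‖ ^ 2) with hQ
  -- A common Gronwall factor: every characteristic segment has length at most `R - Ξ` and carries
  -- flux at most `Q`.
  set E : ℝ := Real.exp (κ * (R - Ξ + Q)) with hE
  have hEpos : 0 < E := Real.exp_pos _
  set Mv : ℝ := (1 + B ^ 2) * E with hMv
  have hMvpos : 0 < Mv := by positivity
  set Mu : ℝ := (1 + (B ^ 2 + Λ ^ 2 * Mv)) * E with hMu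
  have hMupos : 0 < Mu := by positivity
  refine ⟨Mu + Mv + 1, fun f g u v hg hfg hfκ h p hp => ?_⟩
  have huc := h.contDiff_u.continuous
  have hvc := h.contDiff_v.continuous
  have hexp : ∀ {k : ℝ → ℝ} {a b : ℝ}, Continuous k → a ≤ b → b - a ≤ R - Ξ →
      ∫ s in a..b, k s ≤ Q → Real.exp (∫ s in a..b, κ * (1 + k s)) ≤ E := by
    intro k a b hk hab hba hi
    rw [hE, intervalIntegral.integral_const_mul, intervalIntegral.integral_add
      (by simp) (hk.intervalIntegrable _ _)]
    simp only [intervalIntegral.integral_const, smul_eq_mul, mul_one]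
    gcongr
  -- The bound for `v` comes first: it starts from the initial line alone, whereas `u` may start at
  -- the boundary with value `μ v`.
  have hbv : ∀ p ∈ charDomain A Ξ R, 1 + ‖v p.1 p.2‖ ^ 2 ≤ Mv := by
    intro p hp
    have hle := hA.le_of_mem hp
    have h0 := hA.nonneg_of_mem hp
    have hcu : Continuous fun s => ‖u s p.2‖ ^ 2 :=
      (huc.comp (by fun_prop : Continuous fun s => (s, p.2))).norm.pow 2
    have h1 := le_mul_exp_of_neg_le_deriv (y := fun s => 1 + ‖v s p.2‖ ^ 2)
      (y' := fun s => 2 * inner ℝ (v s p.2) (g (u s p.2, v s p.2)))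
      (k := fun s => κ * (1 + ‖u s p.2‖ ^ 2)) hle
      (fun s hs => ((h.eq_v _ (hA.mem_of_mem_left hp hs)).norm_sq).const_add 1)
      (by fun_prop)
      (fun s _ => by
        have h2 := hfκ (u s p.2, v s p.2)
        have h3 := hfg (u s p.2, v s p.2)
        simp only at h2 h3 ⊢
        rw [← h3]
        linarith [neg_abs_le (inner ℝ (u s p.2) (f (u s p.2, v s p.2)))])
    refine h1.trans ?_
    have h4 : ‖v p.2 p.2‖ ≤ B := by
      rw [h.diag_v _ ⟨h0, hp.2.2⟩]
      exact (norm_snd_le (u₀ p.2, v₀ p.2)).trans (hB p.2 ⟨h0, hp.2.2⟩)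
    have h5 := hexp hcu hle (by linarith [hp.1, hp.2.2])
      (h.flux_bounds hA hAd hg hu hv hfg hμA hp).2
    rw [hMv]
    gcongr
  have hbu : 1 + ‖u p.1 p.2‖ ^ 2 ≤ Mu := by
    have hle := hA.le_of_mem hp
    have hcv : Continuous fun s => ‖v p.1 s‖ ^ 2 :=
      (hvc.comp (by fun_prop : Continuous fun s => (p.1, s))).norm.pow 2
    have h1 := le_mul_exp_of_deriv_le (y := fun s => 1 + ‖u p.1 s‖ ^ 2)
      (y' := fun s => 2 * inner ℝ (u p.1 s) (f (u p.1 s, v p.1 s)))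
      (k := fun s => κ * (1 + ‖v p.1 s‖ ^ 2)) hp.2.1
      (fun s hs => ((h.eq_u _ (hA.mem_of_mem_below hp hs)).norm_sq).const_add 1)
      (by fun_prop)
      (fun s _ => by
        have h2 := hfκ (u p.1 s, v p.1 s)
        simp only at h2 ⊢
        linarith [le_abs_self (inner ℝ (u p.1 s) (f (u p.1 s, v p.1 s)))])
    refine h1.trans ?_
    have h4 : ‖u p.1 (entry A p.1)‖ ^ 2 ≤ B ^ 2 + Λ ^ 2 * Mv := by
      rcases le_total 0 p.1 with h0 | h0
      · have hR : p.1 ≤ R := hle.trans hp.2.2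
        rw [hA.entry_of_nonneg h0, h.diag_u _ ⟨h0, hR⟩]
        have h6 := (norm_fst_le (u₀ p.1, v₀ p.1)).trans (hB p.1 ⟨h0, hR⟩)
        have : ‖u₀ p.1‖ ^ 2 ≤ B ^ 2 := by gcongr
        have : 0 ≤ Λ ^ 2 * Mv := by positivity
        linarith
      · have hm := hA.entry_mem hp.1 (h0.trans hA.nonneg)
        have h7 := hbv _ hm
        rw [hA.entry_of_nonpos h0] at h7 ⊢
        rw [h.boundary _ ⟨hp.1, h0⟩, norm_mul, mul_pow]
        have h8 : ‖μ p.1‖ ^ 2 ≤ Λ ^ 2 := by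
          gcongr
          exact hΛ _ ⟨hp.1, h0⟩
        have h9 : ‖v p.1 (A p.1)‖ ^ 2 ≤ Mv := by
          simp only at h7; linarith
        have := mul_le_mul h8 h9 (by positivity) (by positivity)
        nlinarith [sq_nonneg B]
    have hen : p.1 ≤ entry A p.1 := le_max_left _ _
    have h5 := hexp hcv hp.2.1 (by linarith [hp.1, hp.2.2])
      (h.flux_bounds hA hAd hg hu hv hfg hμA hp).1
    rw [hMu]
    gcongr
  have hsq : ∀ x : ℝ, x ≤ 1 + x ^ 2 := fun x => by nlinarith [sq_nonneg (x - 1)]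
  have hbv' := hbv p hp
  exact (Prod.norm_def _).trans_le (max_le (by linarith [hsq ‖u p.1 p.2‖])
    (by linarith [hsq ‖v p.1 p.2‖]))

end APriori

/-! ### Algebra and growth of the truncated nonlinearity -/

/-- The right-hand side of `u_η = f(u, v)`, with the nonlinear term multiplied by `χ`. -/
noncomputable def charF (m α β : ℝ) (χ : ℂ × ℂ → ℝ) (w : ℂ × ℂ) : ℂ :=
  Complex.I / 2 * ((m : ℂ) * w.2 - χ w * N₁ α β w.1 w.2)

/-- The right-hand side of `v_ξ = g(u, v)`, with the nonlinear term multiplied by `χ`. -/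
noncomputable def charG (m α β : ℝ) (χ : ℂ × ℂ → ℝ) (w : ℂ × ℂ) : ℂ :=
  -(Complex.I / 2) * ((m : ℂ) * w.1 - χ w * N₂ α β w.1 w.2)

section Nonlinearity

variable {m α β : ℝ} {χ : ℂ × ℂ → ℝ}

theorem contDiff_N₁ : ContDiff ℝ 1 fun w : ℂ × ℂ => N₁ α β w.1 w.2 := by
  have h1 : ContDiff ℝ 1 fun w : ℂ × ℂ => starRingEnd ℂ w.1 :=
    Complex.conjCLE.contDiff.comp contDiff_fst
  have h2 : ContDiff ℝ 1 fun w : ℂ × ℂ => starRingEnd ℂ w.2 :=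
    Complex.conjCLE.contDiff.comp contDiff_snd
  have h3 : ContDiff ℝ 1 fun w : ℂ × ℂ => ((‖w.2‖ ^ 2 : ℝ) : ℂ) :=
    Complex.ofRealCLM.contDiff.comp (contDiff_snd.norm_sq ℝ)
  unfold N₁
  exact ((contDiff_const.mul contDiff_fst).mul h3).add ((contDiff_const.mul contDiff_snd).mul
    ((h1.mul contDiff_snd).add (contDiff_fst.mul h2)))

theorem contDiff_N₂ : ContDiff ℝ 1 fun w : ℂ × ℂ => N₂ α β w.1 w.2 := by
  have h1 : ContDiff ℝ 1 fun w : ℂ × ℂ => starRingEnd ℂ w.1 :=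
    Complex.conjCLE.contDiff.comp contDiff_fst
  have h2 : ContDiff ℝ 1 fun w : ℂ × ℂ => starRingEnd ℂ w.2 :=
    Complex.conjCLE.contDiff.comp contDiff_snd
  have h3 : ContDiff ℝ 1 fun w : ℂ × ℂ => ((‖w.1‖ ^ 2 : ℝ) : ℂ) :=
    Complex.ofRealCLM.contDiff.comp (contDiff_fst.norm_sq ℝ)
  unfold N₂
  exact ((contDiff_const.mul contDiff_snd).mul h3).add ((contDiff_const.mul contDiff_fst).mul
    ((h1.mul contDiff_snd).add (contDiff_fst.mul h2)))

theorem contDiff_charF (hχ : ContDiff ℝ 1 χ) : ContDiff ℝ 1 (charF m α β χ) :=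
  contDiff_const.mul ((contDiff_const.mul contDiff_snd).sub
    ((Complex.ofRealCLM.contDiff.comp hχ).mul contDiff_N₁))

theorem contDiff_charG (hχ : ContDiff ℝ 1 χ) : ContDiff ℝ 1 (charG m α β χ) :=
  contDiff_const.mul ((contDiff_const.mul contDiff_fst).sub
    ((Complex.ofRealCLM.contDiff.comp hχ).mul contDiff_N₂))

/-- The linear part is Lipschitz, and so is a compactly supported `C¹` function. -/
theorem exists_lipschitz_cutoff (hχ : ContDiff ℝ 1 χ) (hs : HasCompactSupport χ)
    {N : ℂ × ℂ → ℂ} (hN : ContDiff ℝ 1 N) (ℓ : ℂ × ℂ →L[ℝ] ℂ) (c : ℂ) :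
    ∃ L : ℝ≥0, LipschitzWith L fun w => c * (ℓ w - χ w * N w) := by
  have hs' : HasCompactSupport fun w => (χ w : ℂ) * N w := by
    have h1 : HasCompactSupport fun w => (χ w : ℂ) :=
      hs.comp_left (g := fun x : ℝ => (x : ℂ)) Complex.ofReal_zero
    exact h1.mul_right
  obtain ⟨C, hC⟩ := ContDiff.lipschitzWith_of_hasCompactSupport (𝕂 := ℝ) hs'
    ((Complex.ofRealCLM.contDiff.comp hχ).mul hN) one_ne_zero
  have h := (ContinuousLinearMap.mul ℝ ℂ c).lipschitz.comp (ℓ.lipschitz.sub hC)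
  exact ⟨_, h⟩

theorem exists_lipschitz_charF_charG (m α β : ℝ) (hχ : ContDiff ℝ 1 χ)
    (hs : HasCompactSupport χ) :
    ∃ L : ℝ≥0, LipschitzWith L (charF m α β χ) ∧ LipschitzWith L (charG m α β χ) := by
  obtain ⟨L₁, h₁⟩ := exists_lipschitz_cutoff hχ hs (contDiff_N₁ (α := α) (β := β))
    ((ContinuousLinearMap.mul ℝ ℂ (m : ℂ)).comp (ContinuousLinearMap.snd ℝ ℂ ℂ)) (Complex.I / 2)
  obtain ⟨L₂, h₂⟩ := exists_lipschitz_cutoff hχ hs (contDiff_N₂ (α := α) (β := β))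
    ((ContinuousLinearMap.mul ℝ ℂ (m : ℂ)).comp (ContinuousLinearMap.fst ℝ ℂ ℂ))
    (-(Complex.I / 2))
  exact ⟨max L₁ L₂, h₁.weaken (le_max_left _ _), h₂.weaken (le_max_right _ _)⟩

/-- The right-hand side is `Im(ū v)(2χβ Re(ū v) - m/2)`. The `α` term drops out because it is an
imaginary multiple of `u`. The same expression arises from `charG`, which is conservation of charge;
it survives truncation because one real factor `χ` multiplies both nonlinear terms. -/
theorem inner_charF (w : ℂ × ℂ) :
    inner ℝ w.1 (charF m α β χ w) = (w.1.re * w.2.im - w.1.im * w.2.re)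
      * (2 * χ w * β * (w.1.re * w.2.re + w.1.im * w.2.im) - m / 2) := by
  have hI : Complex.I / 2 = ⟨0, 1 / 2⟩ := by
    apply Complex.ext <;> simp
  obtain ⟨⟨a, b⟩, ⟨c, d⟩⟩ := w
  simp only [Complex.inner, charF, N₁, hI, Complex.sq_norm, Complex.normSq_mk]
  simp [Complex.mul_re, Complex.mul_im]
  ring

theorem inner_charG (w : ℂ × ℂ) :
    inner ℝ w.2 (charG m α β χ w) = (w.1.re * w.2.im - w.1.im * w.2.re)
      * (2 * χ w * β * (w.1.re * w.2.re + w.1.im * w.2.im) - m / 2) := by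
  have hI : Complex.I / 2 = ⟨0, 1 / 2⟩ := by
    apply Complex.ext <;> simp
  obtain ⟨⟨a, b⟩, ⟨c, d⟩⟩ := w
  simp only [Complex.inner, charG, N₂, hI, Complex.sq_norm, Complex.normSq_mk]
  simp [Complex.mul_re, Complex.mul_im]
  ring

/-- From `Im(ū v)² + Re(ū v)² = |u|²|v|²` and the inequality between means. The bound is uniform
over cutoffs with values in `[0, 1]`, which lets the cutoff be chosen after the a priori bound. -/
theorem abs_inner_charF_le (hm : 0 ≤ m) (hχ0 : ∀ w, 0 ≤ χ w) (hχ1 : ∀ w, χ w ≤ 1) (w : ℂ × ℂ) :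
    2 * |inner ℝ w.1 (charF m α β χ w)|
      ≤ (m + 4 * |β|) * (1 + ‖w.1‖ ^ 2) * (1 + ‖w.2‖ ^ 2) := by
  rw [inner_charF, abs_mul, Complex.sq_norm, Complex.sq_norm, Complex.normSq_apply,
    Complex.normSq_apply]
  set k := w.1.re * w.2.im - w.1.im * w.2.re with hk
  set s := w.1.re * w.2.re + w.1.im * w.2.im with hs
  set X := w.1.re * w.1.re + w.1.im * w.1.im with hX
  set Y := w.2.re * w.2.re + w.2.im * w.2.im with hY
  have hX0 : 0 ≤ X := add_nonneg (mul_self_nonneg _) (mul_self_nonneg _)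
  have hY0 : 0 ≤ Y := add_nonneg (mul_self_nonneg _) (mul_self_nonneg _)
  have hks : k ^ 2 + s ^ 2 = X * Y := by rw [hk, hs, hX, hY]; ring
  have h1 : |k| * |s| ≤ X * Y := by
    nlinarith [sq_nonneg (|k| - |s|), sq_abs k, sq_abs s, mul_nonneg hX0 hY0]
  have h2 : |k| ≤ 1 + X * Y := by
    nlinarith [sq_nonneg (|k| - 1), sq_abs k, sq_nonneg s]
  have h3 : |2 * χ w * β * s - m / 2| ≤ 2 * |β| * |s| + m / 2 := by
    refine (abs_sub _ _).trans ?_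
    rw [abs_mul, abs_mul, abs_mul, abs_of_nonneg (hχ0 w), abs_of_nonneg (by linarith : 0 ≤ m / 2),
      abs_of_nonneg (zero_le_two)]
    have := mul_le_mul_of_nonneg_right (hχ1 w) (by positivity : 0 ≤ 2 * |β| * |s|)
    nlinarith
  have h4 : |k| * |2 * χ w * β * s - m / 2| ≤ |k| * (2 * |β| * |s| + m / 2) := by gcongr
  have h5 : |β| * (|k| * |s|) ≤ |β| * (X * Y) := by gcongr
  have h6 : m * |k| ≤ m * (1 + X * Y) := by gcongr
  have h7 : 0 ≤ |β| * (1 + X + Y) := by positivity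
  have h8 : 0 ≤ m * (X + Y) := by positivity
  nlinarith

end Nonlinearity

/-! ### Removing the cutoff -/

section Untruncated

variable {f g f' g' : ℂ × ℂ → ℂ} {A : ℝ → ℝ} {Ξ R : ℝ} {μ u₀ v₀ : ℝ → ℂ}

theorem IsCharSolution.congr (hA : IsCharBoundary A Ξ R) {U V : ℝ × ℝ → ℂ}
    (h : IsCharSolution f g A Ξ R μ u₀ v₀ U V)
    (hf : ∀ p ∈ charDomain A Ξ R, f (U p, V p) = f' (U p, V p))
    (hg : ∀ p ∈ charDomain A Ξ R, g (U p, V p) = g' (U p, V p)) :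
    IsCharSolution f' g' A Ξ R μ u₀ v₀ U V := by
  refine ⟨h.contU, h.contV, fun p hp => ?_, fun p hp => ?_⟩
  · rw [h.eqU p hp]
    congr 1
    refine integral_congr fun s hs => ?_
    rw [uIcc_of_le hp.2.1] at hs
    exact hf _ (hA.mem_of_mem_below hp hs)
  · rw [h.eqV p hp]
    congr 1
    refine integral_congr fun s hs => ?_
    rw [uIcc_of_le (hA.le_of_mem hp)] at hs
    exact hg _ (hA.mem_of_mem_left hp hs)

variable {m α β : ℝ}

/-- A smooth cutoff, equal to `1` on the ball of radius `M`. -/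
theorem exists_cutoff (M : ℝ) : ∃ χ : ℂ × ℂ → ℝ, ContDiff ℝ 1 χ ∧ HasCompactSupport χ ∧
    (∀ w, 0 ≤ χ w) ∧ (∀ w, χ w ≤ 1) ∧ ∀ w, ‖w‖ ≤ M → χ w = 1 := by
  let χ : ContDiffBump (0 : ℂ × ℂ) := ⟨max M 1, max M 1 + 1, by positivity, by linarith⟩
  exact ⟨χ, χ.contDiff, χ.hasCompactSupport, χ.nonneg', fun _ => χ.le_one, fun w hw =>
    χ.one_of_mem_closedBall (mem_closedBall_zero_iff.2 (hw.trans (le_max_left _ _)))⟩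

theorem charF_eq_of_cutoff {χ : ℂ × ℂ → ℝ} {w : ℂ × ℂ} (h : χ w = 1) :
    charF m α β χ w = charF m α β (fun _ => 1) w := by
  simp [charF, h]

theorem charG_eq_of_cutoff {χ : ℂ × ℂ → ℝ} {w : ℂ × ℂ} (h : χ w = 1) :
    charG m α β χ w = charG m α β (fun _ => 1) w := by
  simp [charG, h]

/-- Uniqueness for the integrated problem. -/
theorem eqOn_of_isCharSolution (hA : IsCharBoundary A Ξ R) (hμ : Continuous μ)
    (hu : Continuous u₀) (hv : Continuous v₀) {U V U' V' : ℝ × ℝ → ℂ}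
    (h : IsCharSolution (charF m α β fun _ => 1) (charG m α β fun _ => 1) A Ξ R μ u₀ v₀ U V)
    (h' : IsCharSolution (charF m α β fun _ => 1) (charG m α β fun _ => 1) A Ξ R μ u₀ v₀ U' V') :
    EqOn U U' (charDomain A Ξ R) ∧ EqOn V V' (charDomain A Ξ R) := by
  obtain ⟨M, hM⟩ := hA.isCompact.exists_bound_of_continuousOn (h.contU.prodMk h.contV)
  obtain ⟨M', hM'⟩ := hA.isCompact.exists_bound_of_continuousOn (h'.contU.prodMk h'.contV)
  -- Both solutions are bounded on the compact domain, so they also solve one common truncated,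
  -- Lipschitz problem.
  obtain ⟨χ, hχ, hs, -, -, h1⟩ := exists_cutoff (max M M')
  obtain ⟨L, hLf, hLg⟩ := exists_lipschitz_charF_charG m α β hχ hs
  have e := fun p hp => h1 _ ((hM p hp).trans (le_max_left _ _))
  have e' := fun p hp => h1 _ ((hM' p hp).trans (le_max_right _ _))
  exact (h.congr hA (fun p hp => (charF_eq_of_cutoff (e p hp)).symm)
    fun p hp => (charG_eq_of_cutoff (e p hp)).symm).unique hA hLf hLg hμ hu hv
    (h'.congr hA (fun p hp => (charF_eq_of_cutoff (e' p hp)).symm)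
      fun p hp => (charG_eq_of_cutoff (e' p hp)).symm)

/-- Existence of a `C¹` solution in characteristic coordinates. -/
theorem exists_isClassicalCharSolution (hm : 0 ≤ m) (hA : IsCharBoundary A Ξ R)
    (hAd : ContDiff ℝ 1 A) (hμ : ContDiff ℝ 1 μ) (hu : ContDiff ℝ 1 u₀) (hv : ContDiff ℝ 1 v₀)
    (hμA : ∀ ξ ∈ Icc Ξ 0, ‖μ ξ‖ ^ 2 ≤ -deriv A ξ) (hcomp₀ : u₀ 0 = μ 0 * v₀ 0)
    (hcomp₁ : CharCompatible (charF m α β fun _ => 1) (charG m α β fun _ => 1) A μ u₀ v₀) :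
    ∃ u v, IsClassicalCharSolution (charF m α β fun _ => 1) (charG m α β fun _ => 1)
      A Ξ R μ u₀ v₀ u v := by
  obtain ⟨M, hM⟩ := exists_apriori_bound hA hAd hμ.continuous hu.continuous hv.continuous hμA
    (show 0 ≤ m + 4 * |β| by positivity)
  -- The radius exceeds the a priori bound, so truncation is invisible to the solution. It also
  -- covers the corner value, so the compatibility condition is the same for the truncated problem.
  obtain ⟨χ, hχ, hs, h0, h1, hχM⟩ := exists_cutoff (max M ‖(u₀ 0, v₀ 0)‖)
  obtain ⟨L, hLf, hLg⟩ := exists_lipschitz_charF_charG m α β hχ hs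
  have hχ0 : χ (u₀ 0, v₀ 0) = 1 := hχM _ (le_max_right _ _)
  obtain ⟨u, v, h⟩ := exists_isClassicalCharSolution_of_lipschitz hA hAd hLf hLg
    (contDiff_charF hχ) (contDiff_charG hχ) hμ hu hv hcomp₀ (by
      unfold CharCompatible at hcomp₁ ⊢
      rwa [charF_eq_of_cutoff hχ0, charG_eq_of_cutoff hχ0])
  have hb := hM _ _ u v hLg.continuous (fun w => (inner_charF w).trans (inner_charG w).symm)
    (abs_inner_charF_le hm h0 h1) h
  have e := fun p hp => hχM _ ((hb p hp).trans (le_max_left _ _))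
  refine ⟨u, v, h.contDiff_u, h.contDiff_v, fun p hp => ?_, fun p hp => ?_, h.diag_u, h.diag_v,
    h.boundary⟩
  · rw [← charF_eq_of_cutoff (e p hp)]; exact h.eq_u p hp
  · rw [← charG_eq_of_cutoff (e p hp)]; exact h.eq_v p hp

end Untruncated

/-! ### The boundary curve and the data in characteristic coordinates -/

/-- A `C¹` function on the half-line agrees on `[0, N]` with a `C¹` function on the line whose
derivative is constant outside `[0, N]`. -/
theorem exists_contDiff_eqOn_Icc {E : Type*} [NormedAddCommGroup E] [NormedSpace ℝ E]
    [CompleteSpace E] {f : ℝ → E} (hf : ContDiffOn ℝ 1 f (Ici 0)) (N : ℝ) :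
    ∃ F : ℝ → E, ContDiff ℝ 1 F ∧ (∀ t, HasDerivAt F (halfDeriv f (max 0 (min t N))) t) ∧
      EqOn F f (Icc 0 N) := by
  have hd : ContinuousOn (halfDeriv f) (Ici 0) :=
    hf.continuousOn_derivWithin (uniqueDiffOn_Ici 0) le_rfl
  have hc : Continuous fun s => halfDeriv f (max 0 (min s N)) :=
    hd.comp_continuous (by fun_prop) fun s => mem_Ici.2 (le_max_left _ _)
  have hF : ∀ t, HasDerivAt (fun t => f 0 + ∫ s in (0 : ℝ)..t, halfDeriv f (max 0 (min s N)))
      (halfDeriv f (max 0 (min t N))) t := fun t =>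
    (hc.integral_hasStrictDerivAt 0 t).hasDerivAt.const_add _
  refine ⟨_, ?_, hF, fun t ht => ?_⟩
  · rw [contDiff_one_iff_deriv]
    exact ⟨fun t => (hF t).differentiableAt, hc.congr fun t => (hF t).deriv.symm⟩
  · rw [integral_eq_sub_of_hasDerivAt_of_le ht.1 (hf.continuousOn.mono Icc_subset_Ici_self)
      (fun s hs => ?_) (hc.intervalIntegrable _ _), add_sub_cancel]
    rw [max_eq_right (le_min hs.1.le (hs.1.le.trans (hs.2.le.trans ht.2))),
      min_eq_left (hs.2.le.trans ht.2)]
    exact ((hf.differentiableOn one_ne_zero s hs.1.le).hasDerivWithinAt).hasDerivAt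
      (Ici_mem_nhds hs.1)

/-- The uniform lower bound on the derivative, rather than positivity alone, makes `ζ` surjective
onto the line. -/
theorem exists_contDiff_inverse {ζ : ℝ → ℝ} (hζ : ContDiff ℝ 1 ζ) {ε : ℝ} (hε : 0 < ε)
    (hd : ∀ t, ε ≤ deriv ζ t) :
    ∃ τ : ℝ → ℝ, ContDiff ℝ 1 τ ∧ (∀ t, τ (ζ t) = t) ∧ ∀ s, ζ (τ s) = s := by
  have hdiff := hζ.differentiable one_ne_zero
  have hmono : StrictMono ζ := strictMono_of_deriv_pos fun t => hε.trans_le (hd t)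
  have hlin : Monotone fun t => ζ t - ε * t := by
    have hD : ∀ t, HasDerivAt (fun t => ζ t - ε * t) (deriv ζ t - ε * 1) t := fun t =>
      (hdiff t).hasDerivAt.sub ((hasDerivAt_id t).const_mul ε)
    refine monotone_of_deriv_nonneg (fun t => (hD t).differentiableAt) fun t => ?_
    rw [(hD t).deriv]
    linarith [hd t]
  have hsurj : Function.Surjective ζ := by
    refine hζ.continuous.surjective ?_ ?_
    · refine tendsto_atTop_mono' atTop (f₁ := fun t => ε * t + ζ 0) ?_
        (tendsto_atTop_add_const_right _ _ (tendsto_id.const_mul_atTop hε))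
      filter_upwards [eventually_ge_atTop 0] with t ht
      have := hlin ht
      simp only [mul_zero, sub_zero] at this
      linarith
    · refine tendsto_atBot_mono' atBot (f₁ := fun t => ε * t + ζ 0) ?_
        (tendsto_atBot_add_const_right _ _ (tendsto_id.const_mul_atBot hε))
      filter_upwards [eventually_le_atBot 0] with t ht
      have := hlin ht
      simp only [mul_zero, sub_zero] at this
      linarith
  let e := (hmono.orderIsoOfSurjective ζ hsurj).toHomeomorph
  refine ⟨e.symm, e.contDiff_symm_deriv (f' := deriv ζ) (fun t => (hε.trans_le (hd t)).ne')
    (fun t => (hdiff t).hasDerivAt) hζ, fun t => e.symm_apply_apply t,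
    fun s => e.apply_symm_apply s⟩

section Boundary

variable {z : ℝ → ℝ}

theorem strictAntiOn_sub_id (hz : ContDiffOn ℝ 1 z (Ici 0))
    (h : ∀ t, 0 ≤ t → halfDeriv z t < 1) : StrictAntiOn (fun t => z t - t) (Ici 0) := by
  refine strictAntiOn_of_deriv_neg (convex_Ici 0) (hz.continuousOn.sub continuousOn_id)
    fun t ht => ?_
  rw [interior_Ici] at ht
  have h1 : HasDerivAt z (halfDeriv z t) t :=
    ((hz.differentiableOn one_ne_zero t (mem_Ioi.1 ht).le).hasDerivWithinAt).hasDerivAt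
      (Ici_mem_nhds ht)
  have h2 : HasDerivAt (fun t => z t - t) (halfDeriv z t - 1) t := h1.sub (hasDerivAt_id t)
  rw [h2.deriv]
  linarith [h t (mem_Ioi.1 ht).le]

theorem strictMonoOn_add_id (hz : ContDiffOn ℝ 1 z (Ici 0))
    (h : ∀ t, 0 ≤ t → -1 < halfDeriv z t) : StrictMonoOn (fun t => z t + t) (Ici 0) := by
  refine strictMonoOn_of_deriv_pos (convex_Ici 0) (hz.continuousOn.add continuousOn_id)
    fun t ht => ?_
  rw [interior_Ici] at ht
  have h1 : HasDerivAt z (halfDeriv z t) t :=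
    ((hz.differentiableOn one_ne_zero t (mem_Ioi.1 ht).le).hasDerivWithinAt).hasDerivAt
      (Ici_mem_nhds ht)
  have h2 : HasDerivAt (fun t => z t + t) (halfDeriv z t + 1) t := h1.add (hasDerivAt_id t)
  rw [h2.deriv]
  linarith [h t (mem_Ioi.1 ht).le]

/-- The part of the region, in characteristic coordinates, that is determined by the data up to
the boundary time `N`. -/
def charRegion (z : ℝ → ℝ) (N : ℝ) : Set (ℝ × ℝ) :=
  {p | ((p.1 + p.2) / 2, (p.2 - p.1) / 2) ∈ region z ∧ z N - N ≤ p.1 ∧ p.2 ≤ 2 * N + z N}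

/-- The data of the problem up to the boundary time `N`, in characteristic coordinates, extended
to the line. -/
structure IsCharData (z : ℝ → ℝ) (lam u₀ v₀ : ℝ → ℂ) (N : ℝ) (A : ℝ → ℝ) (μ a b : ℝ → ℂ) :
    Prop where
  boundary : IsCharBoundary A (z N - N) (2 * N + z N)
  contDiff_A : ContDiff ℝ 1 A
  contDiff_μ : ContDiff ℝ 1 μ
  contDiff_a : ContDiff ℝ 1 a
  contDiff_b : ContDiff ℝ 1 b
  a_eq : ∀ ξ ∈ Icc 0 (2 * N + z N), a ξ = u₀ ξ
  b_eq : ∀ ξ ∈ Icc 0 (2 * N + z N), b ξ = v₀ ξ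
  curve : ∀ ξ ∈ Icc (z N - N) 0, ∃ t ∈ Icc 0 N, z t - t = ξ
  A_curve : ∀ t ∈ Icc 0 N, A (z t - t) = z t + t
  μ_curve : ∀ t ∈ Icc 0 N, μ (z t - t) = lam t

/-- On `ξ = const ≤ 0` the boundary is met at the unique time `s` with `z s - s = ξ`; as `z t - t`
decreases, a point lies in the region exactly when its time is at least `s`. Hence the domain does
not depend on how the data are extended. -/
theorem IsCharData.charDomain_eq {lam u₀ v₀ : ℝ → ℂ} {N : ℝ} {A : ℝ → ℝ} {μ a b : ℝ → ℂ}
    (hanti : StrictAntiOn (fun t => z t - t) (Ici 0)) (hz0 : z 0 = 0)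
    (h : IsCharData z lam u₀ v₀ N A μ a b) :
    charDomain A (z N - N) (2 * N + z N) = charRegion z N := by
  ext ⟨ξ, η⟩
  simp only [charDomain, charRegion, region, mem_ofPred_eq]
  suffices hs : z N - N ≤ ξ →
      (entry A ξ ≤ η ↔ 0 ≤ (η - ξ) / 2 ∧ z ((η - ξ) / 2) ≤ (ξ + η) / 2) by
    constructor
    · rintro ⟨h1, h2, h3⟩; exact ⟨(hs h1).1 h2, h1, h3⟩
    · rintro ⟨h1, h2, h3⟩; exact ⟨h2, (hs h2).2 h1, h3⟩
  intro hξ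
  rcases le_total 0 ξ with h0 | h0
  · rw [h.boundary.entry_of_nonneg h0]
    refine ⟨fun h1 => ⟨by linarith, ?_⟩, fun h1 => by linarith [h1.1]⟩
    have ht : (0 : ℝ) ≤ (η - ξ) / 2 := by linarith
    have := hanti.antitoneOn (mem_Ici.2 le_rfl) (mem_Ici.2 ht) ht
    simp only [hz0] at this
    linarith
  · obtain ⟨s, hs, rfl⟩ := h.curve ξ ⟨hξ, h0⟩
    rw [h.boundary.entry_of_nonpos h0, h.A_curve s hs]
    constructor
    · intro h1
      have hst : s ≤ (η - (z s - s)) / 2 := by linarith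
      have ht : (0 : ℝ) ≤ (η - (z s - s)) / 2 := hs.1.trans hst
      refine ⟨ht, ?_⟩
      have := hanti.antitoneOn (mem_Ici.2 hs.1) (mem_Ici.2 ht) hst
      beta_reduce at this
      linarith
    · rintro ⟨h1, h2⟩
      have : s ≤ (η - (z s - s)) / 2 := by
        rw [← hanti.le_iff_ge (mem_Ici.2 h1) (mem_Ici.2 hs.1)]
        linarith
      linarith

/-- With `σ` the inverse of `t ↦ t - Z t` for an extension `Z` of `z`, the boundary time at `ξ` is
`σ(-ξ)`. Hence `A ξ = ξ + 2σ(-ξ)`, and `μ` is the extended `lam` at that time. Then `A' = -(1 +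
Z')/(1 - Z')`, which turns (H2) into `|μ|² ≤ -A'`; dividing the corner condition by `1 - z_t(0)`
gives its characteristic form. -/
theorem exists_isCharData (hz : ContDiffOn ℝ 1 z (Ici 0)) {lam : ℝ → ℂ}
    (hlam : ContDiffOn ℝ 1 lam (Ici 0)) (hz0 : z 0 = 0)
    (H1 : ∀ t : ℝ, 0 ≤ t → -1 < halfDeriv z t ∧ halfDeriv z t < 1)
    (H2 : ∀ t : ℝ, 0 ≤ t → ‖lam t‖ ^ 2 * (1 - halfDeriv z t) ≤ 1 + halfDeriv z t)
    {u₀ v₀ : ℝ → ℂ} (hu₀ : ContDiffOn ℝ 1 u₀ (Ici 0)) (hv₀ : ContDiffOn ℝ 1 v₀ (Ici 0))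
    {f g : ℂ × ℂ → ℂ} (hcomp₁ : (1 - ((halfDeriv z 0 : ℝ) : ℂ)) * halfDeriv u₀ 0
        + lam 0 * (1 + ((halfDeriv z 0 : ℝ) : ℂ)) * halfDeriv v₀ 0
        - 2 * lam 0 * g (u₀ 0, v₀ 0) - 2 * f (u₀ 0, v₀ 0) + halfDeriv lam 0 * v₀ 0 = 0)
    {N : ℝ} (hN : 0 < N) :
    ∃ A μ a b, IsCharData z lam u₀ v₀ N A μ a b ∧
      (∀ ξ ∈ Icc (z N - N) 0, ‖μ ξ‖ ^ 2 ≤ -deriv A ξ) ∧ CharCompatible f g A μ a b := by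
  obtain ⟨Z, hZ, hZd, hZz⟩ := exists_contDiff_eqOn_Icc hz N
  obtain ⟨ℓ, hℓ, hℓd, hℓl⟩ := exists_contDiff_eqOn_Icc hlam N
  obtain ⟨a, ha, had, hau⟩ := exists_contDiff_eqOn_Icc hu₀ (2 * N + z N)
  obtain ⟨b, hb, hbd, hbv⟩ := exists_contDiff_eqOn_Icc hv₀ (2 * N + z N)
  have hNmem : N ∈ Icc 0 N := ⟨hN.le, le_rfl⟩
  have h0mem : (0 : ℝ) ∈ Icc 0 N := ⟨le_rfl, hN.le⟩
  have hanti := strictAntiOn_sub_id hz fun t ht => (H1 t ht).2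
  have hmono := strictMonoOn_add_id hz fun t ht => (H1 t ht).1
  have hzN : 0 ≤ z N + N := by
    have := hmono.monotoneOn (mem_Ici.2 le_rfl) (mem_Ici.2 hN.le) hN.le
    simpa [hz0] using this
  have hzN' : z N - N ≤ 0 := by
    have := hanti.antitoneOn (mem_Ici.2 le_rfl) (mem_Ici.2 hN.le) hN.le
    simpa [hz0] using this
  -- The derivative of the extension takes only values of `z_t` on `[0, N]`, so (H1) persists on the
  -- whole line, and compactness makes it uniform.
  have hZ1 : ∀ t, -1 < deriv Z t ∧ deriv Z t < 1 := fun t => by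
    rw [(hZd t).deriv]; exact H1 _ (le_max_left _ _)
  have hζC : ContDiff ℝ 1 fun t => t - Z t := contDiff_id.sub hZ
  have hζd : ∀ t, HasDerivAt (fun t => t - Z t) (1 - deriv Z t) t := fun t =>
    (hasDerivAt_id t).sub (hZ.differentiable one_ne_zero t).hasDerivAt
  obtain ⟨ε, hε, hεd⟩ : ∃ ε > 0, ∀ t, ε ≤ deriv (fun t => t - Z t) t := by
    have hcont : ContinuousOn (halfDeriv z) (Icc 0 N) :=
      (hz.continuousOn_derivWithin (uniqueDiffOn_Ici 0) le_rfl).mono Icc_subset_Ici_self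
    obtain ⟨s, hs, hmax⟩ := isCompact_Icc.exists_isMaxOn ⟨0, h0mem⟩ hcont
    refine ⟨1 - halfDeriv z s, by linarith [(H1 s hs.1).2], fun t => ?_⟩
    rw [(hζd t).deriv, (hZd t).deriv]
    have : halfDeriv z (max 0 (min t N)) ≤ halfDeriv z s :=
      hmax ⟨le_max_left _ _, max_le hN.le (min_le_right _ _)⟩
    linarith
  obtain ⟨σ, hσ, hσl, hσr⟩ := exists_contDiff_inverse hζC hε hεd
  have hτC : ContDiff ℝ 1 fun ξ => σ (-ξ) := hσ.comp contDiff_neg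
  have hAC : ContDiff ℝ 1 fun ξ => 2 * σ (-ξ) + ξ := (contDiff_const.mul hτC).add contDiff_id
  have hτ : ∀ t ∈ Icc 0 N, σ (-(z t - t)) = t := fun t ht => by
    rw [← hZz ht, neg_sub]; exact hσl t
  have hτd : ∀ ξ, HasDerivAt (fun ξ => σ (-ξ)) (-(1 - deriv Z (σ (-ξ)))⁻¹) ξ := by
    intro ξ
    have h1 := (hτC.differentiable one_ne_zero ξ).hasDerivAt
    have h2 : HasDerivAt (fun ξ => σ (-ξ) - Z (σ (-ξ)))
        ((1 - deriv Z (σ (-ξ))) * deriv (fun ξ => σ (-ξ)) ξ) ξ :=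
      HasDerivAt.comp ξ (h₂ := fun t => t - Z t) (hζd (σ (-ξ))) h1
    have h3 : HasDerivAt (fun ξ => σ (-ξ) - Z (σ (-ξ))) (-1) ξ := by
      have : (fun ξ => σ (-ξ) - Z (σ (-ξ))) = fun ξ => -ξ := funext fun ξ => hσr (-ξ)
      rw [this]; exact hasDerivAt_neg ξ
    have h4 := h2.unique h3
    have h5 : 1 - deriv Z (σ (-ξ)) ≠ 0 := by linarith [(hZ1 (σ (-ξ))).2]
    refine h1.congr_deriv ?_
    field_simp
    linarith
  have hAd : ∀ ξ, HasDerivAt (fun ξ => 2 * σ (-ξ) + ξ)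
      (2 * -(1 - deriv Z (σ (-ξ)))⁻¹ + 1) ξ := fun ξ =>
    ((hτd ξ).const_mul 2).add (hasDerivAt_id ξ)
  have hAd' : ∀ ξ, deriv (fun ξ => 2 * σ (-ξ) + ξ) ξ
      = -((1 + deriv Z (σ (-ξ))) / (1 - deriv Z (σ (-ξ)))) := fun ξ => by
    have h5 : 1 - deriv Z (σ (-ξ)) ≠ 0 := by linarith [(hZ1 (σ (-ξ))).2]
    rw [(hAd ξ).deriv]
    field_simp
    ring
  have hσ0 : σ 0 = 0 := by
    have := hτ 0 h0mem
    simpa [hz0] using this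
  have hA0 : 2 * σ (-0) + (0 : ℝ) = 0 := by simp [hσ0]
  have hclamp0 : ∀ {M : ℝ}, 0 ≤ M → max 0 (min 0 M) = 0 := fun hM => by
    rw [min_eq_left hM, max_self]
  have hcurve : ∀ ξ ∈ Icc (z N - N) 0, σ (-ξ) ∈ Icc 0 N ∧ z (σ (-ξ)) - σ (-ξ) = ξ := by
    intro ξ hξ
    have hm : StrictMono fun t => t - Z t := strictMono_of_deriv_pos fun t => hε.trans_le (hεd t)
    have hr : σ (-ξ) - Z (σ (-ξ)) = -ξ := hσr (-ξ)
    have h1 : σ (-ξ) ∈ Icc 0 N := by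
      constructor
      · rw [← hm.le_iff_le]
        rw [hr, hZz h0mem, hz0]
        linarith [hξ.2]
      · rw [← hm.le_iff_le]
        rw [hr, hZz hNmem]
        linarith [hξ.1]
    refine ⟨h1, ?_⟩
    rw [← hZz h1]; linarith
  refine ⟨fun ξ => 2 * σ (-ξ) + ξ, fun ξ => ℓ (σ (-ξ)), a, b,
    ⟨⟨hAC.continuous, ?_, hA0, hzN', by linarith, ?_⟩, hAC, hℓ.comp hτC, ha, hb,
      fun ξ hξ => hau hξ, fun ξ hξ => hbv hξ, fun ξ hξ => ⟨_, (hcurve ξ hξ).1, (hcurve ξ hξ).2⟩,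
      fun t ht => ?_, fun t ht => ?_⟩, fun ξ hξ => ?_, ?_⟩
  · refine antitone_of_deriv_nonpos (hAC.differentiable one_ne_zero) fun ξ => ?_
    rw [hAd', neg_nonpos]
    have := hZ1 (σ (-ξ))
    exact div_nonneg (by linarith [this.1]) (by linarith [this.2])
  · rw [hτ N hNmem]; linarith
  · rw [hτ t ht]; ring
  · rw [hτ t ht]; exact hℓl ht
  · obtain ⟨hm, -⟩ := hcurve ξ hξ
    beta_reduce
    rw [hAd', neg_neg, hℓl hm, le_div_iff₀ (by linarith [(hZ1 (σ (-ξ))).2]), (hZd _).deriv,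
      min_eq_left hm.2, max_eq_right hm.1]
    exact H2 _ hm.1
  · have hdZ : deriv Z 0 = halfDeriv z 0 := by rw [(hZd 0).deriv, hclamp0 hN.le]
    have hda : deriv a 0 = halfDeriv u₀ 0 := by rw [(had 0).deriv, hclamp0 (by linarith)]
    have hdb : deriv b 0 = halfDeriv v₀ 0 := by rw [(hbd 0).deriv, hclamp0 (by linarith)]
    have hdμ : deriv (fun ξ => ℓ (σ (-ξ))) 0
        = -((1 - halfDeriv z 0 : ℝ) : ℂ)⁻¹ * halfDeriv lam 0 := by
      have h1 := (hℓd (σ (-0))).scomp (0 : ℝ) (hτd 0)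
      have h2 := h1.deriv
      simp only [Function.comp_def] at h2
      rw [h2, neg_zero, hσ0, hclamp0 hN.le, hdZ, Complex.real_smul]
      push_cast
      ring
    have h00 : (0 : ℝ) ∈ Icc 0 (2 * N + z N) := ⟨le_rfl, by linarith⟩
    unfold CharCompatible
    beta_reduce
    rw [hAd', hdμ, hda, hdb, neg_zero, hσ0, hdZ, hau h00, hbv h00, hℓl h0mem]
    have h5 : (1 - ((halfDeriv z 0 : ℝ) : ℂ)) ≠ 0 := by
      have : (1 - halfDeriv z 0 : ℝ) ≠ 0 := by linarith [(H1 0 le_rfl).2]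
      exact_mod_cast this
    push_cast
    field_simp
    linear_combination hcomp₁

end Boundary

/-! ### Local solutions, change of coordinates and gluing -/

/-- A solution, in characteristic coordinates, on the part of the region determined by the data up
to the boundary time `N`. -/
structure IsLocalCharSolution (m α β : ℝ) (z : ℝ → ℝ) (lam u₀ v₀ : ℝ → ℂ) (N : ℝ)
    (U V : ℝ × ℝ → ℂ) : Prop where
  contU : ContinuousOn U (charRegion z N)
  contV : ContinuousOn V (charRegion z N)
  eqU : ∀ ξ η, (ξ, η) ∈ charRegion z N → ξ < η → z ((η - ξ) / 2) < (ξ + η) / 2 →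
    HasDerivAt (fun η => U (ξ, η)) (charF m α β (fun _ => 1) (U (ξ, η), V (ξ, η))) η
  eqV : ∀ ξ η, (ξ, η) ∈ charRegion z N → ξ < η → z ((η - ξ) / 2) < (ξ + η) / 2 →
    HasDerivAt (fun ξ => V (ξ, η)) (charG m α β (fun _ => 1) (U (ξ, η), V (ξ, η))) ξ
  initial_u : ∀ ξ ∈ Icc 0 (2 * N + z N), U (ξ, ξ) = u₀ ξ
  initial_v : ∀ ξ ∈ Icc 0 (2 * N + z N), V (ξ, ξ) = v₀ ξ
  boundary : ∀ t ∈ Icc 0 N, U (z t - t, z t + t) = lam t * V (z t - t, z t + t)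

section Local

variable {m α β : ℝ} {z : ℝ → ℝ} {lam u₀ v₀ : ℝ → ℂ}

theorem charRegion_mono (hanti : StrictAntiOn (fun t => z t - t) (Ici 0))
    (hmono : StrictMonoOn (fun t => z t + t) (Ici 0)) {N N' : ℝ} (hN : 0 ≤ N) (h : N ≤ N') :
    charRegion z N ⊆ charRegion z N' := by
  rintro p ⟨h1, h2, h3⟩
  have e1 := hanti.antitoneOn (mem_Ici.2 hN) (mem_Ici.2 (hN.trans h)) h
  have e2 := hmono.monotoneOn (mem_Ici.2 hN) (mem_Ici.2 (hN.trans h)) h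
  beta_reduce at e1 e2
  exact ⟨h1, by linarith, by linarith⟩

theorem IsLocalCharSolution.mono (hanti : StrictAntiOn (fun t => z t - t) (Ici 0))
    (hmono : StrictMonoOn (fun t => z t + t) (Ici 0)) {N N' : ℝ} (hN : 0 ≤ N) (h : N ≤ N')
    {U V : ℝ × ℝ → ℂ} (hs : IsLocalCharSolution m α β z lam u₀ v₀ N' U V) :
    IsLocalCharSolution m α β z lam u₀ v₀ N U V := by
  have hsub := charRegion_mono hanti hmono hN h
  have e2 := hmono.monotoneOn (mem_Ici.2 hN) (mem_Ici.2 (hN.trans h)) h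
  beta_reduce at e2
  have hR : 2 * N + z N ≤ 2 * N' + z N' := by linarith
  exact ⟨hs.contU.mono hsub, hs.contV.mono hsub, fun ξ η hp => hs.eqU ξ η (hsub hp),
    fun ξ η hp => hs.eqV ξ η (hsub hp), fun ξ hξ => hs.initial_u ξ ⟨hξ.1, hξ.2.trans hR⟩,
    fun ξ hξ => hs.initial_v ξ ⟨hξ.1, hξ.2.trans hR⟩,
    fun t ht => hs.boundary t ⟨ht.1, ht.2.trans h⟩⟩

/-- The equations, known at interior points, are integrated along characteristics using continuity
up to the end points. Strict monotonicity of `z t - t` and `z t + t` keeps the open segments off the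
boundary curve. -/
theorem IsLocalCharSolution.isCharSolution (hanti : StrictAntiOn (fun t => z t - t) (Ici 0))
    (hmono : StrictMonoOn (fun t => z t + t) (Ici 0)) (hz0 : z 0 = 0) {N : ℝ}
    {A : ℝ → ℝ} {μ a b : ℝ → ℂ} (hd : IsCharData z lam u₀ v₀ N A μ a b)
    {U V : ℝ × ℝ → ℂ} (hs : IsLocalCharSolution m α β z lam u₀ v₀ N U V) :
    IsCharSolution (charF m α β fun _ => 1) (charG m α β fun _ => 1) A (z N - N) (2 * N + z N)
      μ a b U V := by
  have hA := hd.boundary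
  have hdom := hd.charDomain_eq hanti hz0
  have hU : ContinuousOn U (charDomain A (z N - N) (2 * N + z N)) := hdom ▸ hs.contU
  have hV : ContinuousOn V (charDomain A (z N - N) (2 * N + z N)) := hdom ▸ hs.contV
  have hF : Continuous (charF m α β fun _ => 1) := (contDiff_charF contDiff_const).continuous
  have hG : Continuous (charG m α β fun _ => 1) := (contDiff_charG contDiff_const).continuous
  refine ⟨hU, hV, ?_, ?_⟩
  · rintro ⟨ξ, η⟩ hp
    have hseg : MapsTo (fun s => (ξ, s)) (Icc (entry A ξ) η)
        (charDomain A (z N - N) (2 * N + z N)) := fun s hs => hA.mem_of_mem_below hp hs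
    have hcs : Continuous fun s : ℝ => (ξ, s) := by fun_prop
    have hUs := hU.comp hcs.continuousOn hseg
    have hVs := hV.comp hcs.continuousOn hseg
    have hint := integral_eq_sub_of_hasDerivAt_of_le hp.2.1 hUs
      (f' := fun s => charF m α β (fun _ => 1) (U (ξ, s), V (ξ, s))) (fun s hs' => ?_)
      (ContinuousOn.intervalIntegrable_of_Icc hp.2.1
        (hF.comp_continuousOn (hUs.prodMk hVs)))
    · simp only [Function.comp_def] at hint
      rw [hint]
      suffices hE : U (ξ, entry A ξ) = entryValue a μ A V ξ by
        simp only [hE]; ring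
      have hle : ξ ≤ 2 * N + z N := (hA.le_of_mem hp).trans hp.2.2
      rcases le_total 0 ξ with h0 | h0
      · have hV0 : V (0, 0) = b 0 := by
          rw [hs.initial_v 0 ⟨le_rfl, hA.nonneg⟩, hd.b_eq 0 ⟨le_rfl, hA.nonneg⟩]
        have hN : 0 ≤ N := by
          obtain ⟨t, ht, -⟩ := hd.curve 0 ⟨hA.nonpos, le_rfl⟩
          exact ht.1.trans ht.2
        have hbd := hs.boundary 0 ⟨le_rfl, hN⟩
        have hμ0 := hd.μ_curve 0 ⟨le_rfl, hN⟩
        rw [hz0, sub_zero] at hμ0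
        rw [hz0, sub_zero, add_zero, hs.initial_u 0 ⟨le_rfl, hA.nonneg⟩, ← hμ0] at hbd
        simp only [entryValue]
        rw [hA.entry_of_nonneg h0, hs.initial_u ξ ⟨h0, hle⟩, max_eq_left h0, min_eq_right h0,
          hA.zero, hd.a_eq ξ ⟨h0, hle⟩, hd.a_eq 0 ⟨le_rfl, hA.nonneg⟩, hbd]
        ring
      · obtain ⟨t, ht, rfl⟩ := hd.curve ξ ⟨hp.1, h0⟩
        simp only [entryValue]
        rw [hA.entry_of_nonpos h0, max_eq_right h0, min_eq_left h0, hd.A_curve t ht,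
          hd.μ_curve t ht, hs.boundary t ht]
        ring
    · have hm := hseg (Ioo_subset_Icc_self hs')
      have hb := hseg (left_mem_Icc.2 hp.2.1)
      rw [hdom] at hm hb
      refine hs.eqU ξ s hm ((le_max_left _ _).trans_lt hs'.1) ?_
      have h1 := hb.1.2
      have h3 := hanti (mem_Ici.2 hb.1.1) (mem_Ici.2 hm.1.1)
        (show (entry A ξ - ξ) / 2 < (s - ξ) / 2 by linarith [hs'.1])
      simp only at h1 h3
      linarith
  · rintro ⟨ξ, η⟩ hp
    have hle : ξ ≤ η := hA.le_of_mem hp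
    have hη : η ∈ Icc 0 (2 * N + z N) := ⟨hA.nonneg_of_mem hp, hp.2.2⟩
    have hseg : MapsTo (fun s => (s, η)) (Icc ξ η)
        (charDomain A (z N - N) (2 * N + z N)) := fun s hs => hA.mem_of_mem_left hp hs
    have hcs : Continuous fun s : ℝ => (s, η) := by fun_prop
    have hUs := hU.comp hcs.continuousOn hseg
    have hVs := hV.comp hcs.continuousOn hseg
    have hint := integral_eq_sub_of_hasDerivAt_of_le hle hVs
      (f' := fun s => charG m α β (fun _ => 1) (U (s, η), V (s, η))) (fun s hs' => ?_)
      (ContinuousOn.intervalIntegrable_of_Icc hle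
        (hG.comp_continuousOn (hUs.prodMk hVs)))
    · simp only [Function.comp_def] at hint
      rw [hint, hs.initial_v η hη, hd.b_eq η hη]
      ring
    · have hm := hseg (Ioo_subset_Icc_self hs')
      have hb := hp
      rw [hdom] at hm hb
      refine hs.eqV s η hm hs'.2 ?_
      have h1 := hb.1.2
      have h3 := hmono (mem_Ici.2 hm.1.1) (mem_Ici.2 hb.1.1)
        (show (η - s) / 2 < (η - ξ) / 2 by linarith [hs'.1])
      simp only at h1 h3
      linarith

theorem IsClassicalCharSolution.isLocalCharSolution
    (hanti : StrictAntiOn (fun t => z t - t) (Ici 0)) (hz0 : z 0 = 0) {N : ℝ}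
    {A : ℝ → ℝ} {μ a b : ℝ → ℂ} (hd : IsCharData z lam u₀ v₀ N A μ a b)
    {u v : ℝ → ℝ → ℂ}
    (hs : IsClassicalCharSolution (charF m α β fun _ => 1) (charG m α β fun _ => 1)
      A (z N - N) (2 * N + z N) μ a b u v) :
    IsLocalCharSolution m α β z lam u₀ v₀ N (fun p => u p.1 p.2) (fun p => v p.1 p.2) := by
  have hdom := hd.charDomain_eq hanti hz0
  refine ⟨hs.contDiff_u.continuous.continuousOn, hs.contDiff_v.continuous.continuousOn,
    fun ξ η hp _ _ => hs.eq_u (ξ, η) (hdom ▸ hp), fun ξ η hp _ _ => hs.eq_v (ξ, η) (hdom ▸ hp),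
    fun ξ hξ => (hs.diag_u ξ hξ).trans (hd.a_eq ξ hξ),
    fun ξ hξ => (hs.diag_v ξ hξ).trans (hd.b_eq ξ hξ), fun t ht => ?_⟩
  have hξ : z t - t ∈ Icc (z N - N) 0 := by
    have e1 := hanti.antitoneOn (mem_Ici.2 ht.1) (mem_Ici.2 (ht.1.trans ht.2)) ht.2
    have e2 := hanti.antitoneOn (mem_Ici.2 le_rfl) (mem_Ici.2 ht.1) ht.1
    simp only [hz0, sub_zero] at e1 e2
    exact ⟨e1, e2⟩
  have := hs.boundary _ hξ
  rwa [hd.A_curve t ht, hd.μ_curve t ht] at this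

theorem region_mem_nhds (hz : ContinuousOn z (Ici 0)) {x t : ℝ} (ht : 0 < t) (hx : z t < x) :
    region z ∈ 𝓝 (x, t) := by
  have h1 : ∀ᶠ p : ℝ × ℝ in 𝓝 (x, t), 0 < p.2 := continuousAt_snd.eventually_const_lt ht
  have hzc : ContinuousAt z t := hz.continuousAt (Ici_mem_nhds ht)
  have h2 : ∀ᶠ p : ℝ × ℝ in 𝓝 (x, t), z p.2 < p.1 :=
    (ContinuousAt.comp (x := (x, t)) (f := Prod.snd) hzc continuousAt_snd).eventually_lt
      continuousAt_fst hx
  filter_upwards [h1, h2] with p hp1 hp2 using ⟨hp1.le, hp2.le⟩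

theorem hasDerivAt_dx {w : ℝ × ℝ → ℂ} {x t : ℝ} (h : DifferentiableAt ℝ w (x, t)) :
    fderiv ℝ w (x, t) (1, 0) = dx w x t :=
  (HasDerivAt.deriv (h.hasFDerivAt.comp_hasDerivAt x
    ((hasDerivAt_id x).prodMk (hasDerivAt_const x t)))).symm

theorem hasDerivAt_dt {w : ℝ × ℝ → ℂ} {x t : ℝ} (h : DifferentiableAt ℝ w (x, t)) :
    fderiv ℝ w (x, t) (0, 1) = dt w x t :=
  (HasDerivAt.deriv (h.hasFDerivAt.comp_hasDerivAt t
    ((hasDerivAt_const t x).prodMk (hasDerivAt_id t)))).symm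

theorem IsGlobalC1Solution.isLocalCharSolution (hz : ContinuousOn z (Ici 0)) {u v : ℝ × ℝ → ℂ}
    (h : IsGlobalC1Solution m α β z lam u₀ v₀ u v) (N : ℝ) :
    IsLocalCharSolution m α β z lam u₀ v₀ N (fun p => u ((p.1 + p.2) / 2, (p.2 - p.1) / 2))
      (fun p => v ((p.1 + p.2) / 2, (p.2 - p.1) / 2)) := by
  have hmaps : MapsTo (fun p : ℝ × ℝ => ((p.1 + p.2) / 2, (p.2 - p.1) / 2)) (charRegion z N)
      (region z) := fun p hp => hp.1
  have hcc : ContinuousOn (fun p : ℝ × ℝ => ((p.1 + p.2) / 2, (p.2 - p.1) / 2))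
    (charRegion z N) := by fun_prop
  have hdiff : ∀ {w : ℝ × ℝ → ℂ}, ContDiffOn ℝ 1 w (region z) → ∀ {x t : ℝ}, 0 < t → z t < x →
      DifferentiableAt ℝ w (x, t) := fun hw x t ht hx =>
    (hw.contDiffAt (region_mem_nhds hz ht hx)).differentiableAt one_ne_zero
  refine ⟨h.contDiffOn_u.continuousOn.comp hcc hmaps, h.contDiffOn_v.continuousOn.comp hcc hmaps,
    fun ξ η _ h1 h2 => ?_, fun ξ η _ h1 h2 => ?_, fun ξ hξ => ?_, fun ξ hξ => ?_, fun t ht => ?_⟩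
  · have hd := hdiff h.contDiffOn_u (by linarith : 0 < (η - ξ) / 2) h2
    have hc : HasDerivAt (fun η : ℝ => ((ξ + η) / 2, (η - ξ) / 2)) ((1 / 2 : ℝ), (1 / 2 : ℝ)) η :=
      (((hasDerivAt_id η).const_add ξ).div_const 2).prodMk
        (((hasDerivAt_id η).sub_const ξ).div_const 2)
    refine (hd.hasFDerivAt.comp_hasDerivAt η hc).congr_deriv ?_
    have e : ((1 / 2 : ℝ), (1 / 2 : ℝ)) = (1 / 2 : ℝ) • ((0, 1) + (1, 0)) := by simp
    have heq := h.eq_u _ _ (by linarith : 0 < (η - ξ) / 2) h2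
    rw [e, map_smul, map_add, hasDerivAt_dx hd, hasDerivAt_dt hd, Complex.real_smul]
    simp only [charF]
    push_cast
    linear_combination (-Complex.I / 2) * heq + (1 / 2) * (dt u ((ξ + η) / 2) ((η - ξ) / 2)
      + dx u ((ξ + η) / 2) ((η - ξ) / 2)) * Complex.I_sq
  · have hd := hdiff h.contDiffOn_v (by linarith : 0 < (η - ξ) / 2) h2
    have hc : HasDerivAt (fun ξ : ℝ => ((ξ + η) / 2, (η - ξ) / 2)) ((1 / 2 : ℝ), (-1 / 2 : ℝ)) ξ :=
      (((hasDerivAt_id ξ).add_const η).div_const 2).prodMk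
        (((hasDerivAt_id ξ).const_sub η).div_const 2)
    refine (hd.hasFDerivAt.comp_hasDerivAt ξ hc).congr_deriv ?_
    have e : ((1 / 2 : ℝ), (-1 / 2 : ℝ)) = (1 / 2 : ℝ) • ((1, 0) - (0, 1)) := by
      ext <;> norm_num
    have heq := h.eq_v _ _ (by linarith : 0 < (η - ξ) / 2) h2
    rw [e, map_smul, map_sub, hasDerivAt_dx hd, hasDerivAt_dt hd, Complex.real_smul]
    simp only [charG]
    push_cast
    linear_combination (Complex.I / 2) * heq - (1 / 2) * (dt v ((ξ + η) / 2) ((η - ξ) / 2)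
      - dx v ((ξ + η) / 2) ((η - ξ) / 2)) * Complex.I_sq
  · have := h.initial_u ξ hξ.1
    simpa using this
  · have := h.initial_v ξ hξ.1
    simpa using this
  · have := h.boundary t ht.1
    have e : ((z t - t + (z t + t)) / 2, (z t + t - (z t - t)) / 2) = (z t, t) := by
      ext <;> simp only <;> ring
    simpa only [e] using this

/-- These regions exhaust the domain. The upper limit `2N + z N` for `η` is needed because `N + z N`
may stay bounded; adding `N` to this nonnegative number makes the limit at least `N`. -/
theorem mem_charRegion_of_le (hanti : StrictAntiOn (fun t => z t - t) (Ici 0))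
    (hmono : StrictMonoOn (fun t => z t + t) (Ici 0)) (hz0 : z 0 = 0) {N x t : ℝ}
    (h : (x, t) ∈ region z) (ht : t ≤ N) (hx : x + t ≤ N) : (x - t, x + t) ∈ charRegion z N := by
  obtain ⟨h1, h2⟩ := h
  simp only at h1 h2
  have hN := h1.trans ht
  have e1 := hanti.antitoneOn (mem_Ici.2 h1) (mem_Ici.2 hN) ht
  have e2 := hmono.monotoneOn (mem_Ici.2 le_rfl) (mem_Ici.2 hN) hN
  simp only [hz0, add_zero] at e1 e2
  refine ⟨?_, ?_, ?_⟩
  · have e : ((x - t + (x + t)) / 2, (x + t - (x - t)) / 2) = (x, t) := by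
      ext <;> simp only <;> ring
    simp only [e]
    exact ⟨h1, h2⟩
  · simp only; linarith
  · simp only; linarith

/-- Solutions on the characteristic regions glue to a global solution. -/
theorem exists_isGlobalC1Solution_of_local (hz : ContinuousOn z (Ici 0))
    (hanti : StrictAntiOn (fun t => z t - t) (Ici 0))
    (hmono : StrictMonoOn (fun t => z t + t) (Ici 0)) (hz0 : z 0 = 0)
    (hex : ∀ n : ℕ, ∃ U V : ℝ × ℝ → ℂ, ContDiff ℝ 1 U ∧ ContDiff ℝ 1 V ∧
      IsLocalCharSolution m α β z lam u₀ v₀ (n + 1) U V)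
    (huniq : ∀ (n : ℕ) (U V U' V' : ℝ × ℝ → ℂ),
      IsLocalCharSolution m α β z lam u₀ v₀ (n + 1) U V →
      IsLocalCharSolution m α β z lam u₀ v₀ (n + 1) U' V' →
      EqOn U U' (charRegion z (n + 1)) ∧ EqOn V V' (charRegion z (n + 1))) :
    ∃ u v, IsGlobalC1Solution m α β z lam u₀ v₀ u v := by
  choose U V hU hV hs using hex
  let c : ℝ × ℝ → ℝ × ℝ := fun p => (p.1 - p.2, p.1 + p.2)
  have hcC : ContDiff ℝ 1 c :=
    (contDiff_fst.sub contDiff_snd).prodMk (contDiff_fst.add contDiff_snd)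
  -- An index dominating both `t` and `x + t`, so that `p` lies in the region with parameter `k p +
  -- 1`.
  let k : ℝ × ℝ → ℕ := fun p => ⌈p.2⌉₊ + ⌈p.1 + p.2⌉₊
  have hk : ∀ p ∈ region z, c p ∈ charRegion z (k p + 1) := fun p hp => by
    refine mem_charRegion_of_le hanti hmono hz0 hp ?_ ?_
    · have := Nat.le_ceil p.2
      have h2 : (0 : ℝ) ≤ (⌈p.1 + p.2⌉₊ : ℝ) := Nat.cast_nonneg _
      simp only [k]; push_cast; linarith
    · have := Nat.le_ceil (p.1 + p.2)
      have h2 : (0 : ℝ) ≤ (⌈p.2⌉₊ : ℝ) := Nat.cast_nonneg _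
      simp only [k]; push_cast; linarith
  have hle : ∀ i j : ℕ, i ≤ j → ∀ q ∈ charRegion z (i + 1), U i q = U j q ∧ V i q = V j q := by
    intro i j hij q hq
    have h1 := (hs j).mono hanti hmono (N := (i : ℝ) + 1) (by positivity)
      (by have : (i : ℝ) ≤ j := by exact_mod_cast hij
          linarith)
    have h2 := huniq i _ _ _ _ (hs i) h1
    exact ⟨h2.1 hq, h2.2 hq⟩
  have hcons : ∀ i j : ℕ, ∀ q ∈ charRegion z (i + 1), q ∈ charRegion z (j + 1) →
      U i q = U j q ∧ V i q = V j q := by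
    intro i j q hi hj
    rcases le_total i j with hij | hij
    · exact hle i j hij q hi
    · exact ⟨(hle j i hij q hj).1.symm, (hle j i hij q hj).2.symm⟩
  have heqn : ∀ n : ℕ, ∀ p ∈ region z, c p ∈ charRegion z (n + 1) →
      U (k p) (c p) = U n (c p) ∧ V (k p) (c p) = V n (c p) := fun n p hp hn =>
    hcons (k p) n _ (hk p hp) hn
  -- The extra `1` leaves room for a neighbourhood on which one index serves. There, although `k`
  -- jumps, the glued function agrees on the region with a single function that is `C¹` on the
  -- plane; this gives regularity up to the boundary.
  have hloc : ∀ p₀ : ℝ × ℝ, ∀ᶠ p in 𝓝 p₀, p ∈ region z → c p ∈ charRegion z (k p₀ + 1) := by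
    intro p₀
    have h1 : p₀.2 < (k p₀ : ℝ) + 1 := by
      have := Nat.le_ceil p₀.2
      have h2 : (0 : ℝ) ≤ (⌈p₀.1 + p₀.2⌉₊ : ℝ) := Nat.cast_nonneg _
      simp only [k]; push_cast; linarith
    have h2 : p₀.1 + p₀.2 < (k p₀ : ℝ) + 1 := by
      have := Nat.le_ceil (p₀.1 + p₀.2)
      have h2 : (0 : ℝ) ≤ (⌈p₀.2⌉₊ : ℝ) := Nat.cast_nonneg _
      simp only [k]; push_cast; linarith
    filter_upwards [continuousAt_snd.eventually_lt_const h1,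
      (continuousAt_fst.add continuousAt_snd).eventually_lt_const h2] with p hp1 hp2 hp
    exact mem_charRegion_of_le hanti hmono hz0 hp hp1.le hp2.le
  have hbdmem : ∀ t, 0 ≤ t → (z t, t) ∈ region z := fun t ht => ⟨ht, le_rfl⟩
  have hinmem : ∀ x, 0 ≤ x → (x, 0) ∈ region z := fun x hx => ⟨le_rfl, by simpa [hz0] using hx⟩
  have hnear : ∀ {x t : ℝ}, 0 < t → z t < x → ∀ᶠ p in 𝓝 (x, t),
      U (k p) (c p) = U (k (x, t)) (c p) ∧ V (k p) (c p) = V (k (x, t)) (c p) := by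
    intro x t ht hx
    filter_upwards [region_mem_nhds hz ht hx, hloc (x, t)] with p hp hp'
    exact heqn _ p hp (hp' hp)
  have hpart : ∀ {W : ℝ × ℝ → ℂ}, ContDiff ℝ 1 W → ∀ {w : ℝ × ℝ → ℂ} {x t : ℝ},
      w =ᶠ[𝓝 (x, t)] W ∘ c → DifferentiableAt ℝ w (x, t) ∧
        dt w x t = fderiv ℝ W (c (x, t)) (-1, 1) ∧ dx w x t = fderiv ℝ W (c (x, t)) (1, 1) := by
    intro W hW w x t hw
    have hD : HasFDerivAt w _ (x, t) :=
      ((hW.differentiable one_ne_zero (c (x, t))).hasFDerivAt.comp (x, t)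
      (((hasFDerivAt_fst (𝕜 := ℝ)).sub hasFDerivAt_snd).prodMk
        (hasFDerivAt_fst.add hasFDerivAt_snd))).congr_of_eventuallyEq hw
    refine ⟨hD.differentiableAt, ?_, ?_⟩
    · rw [← hasDerivAt_dt hD.differentiableAt, hD.fderiv]; simp
    · rw [← hasDerivAt_dx hD.differentiableAt, hD.fderiv]; simp
  have hchar : ∀ {x t : ℝ}, 0 < t → z t < x →
      (x - t < x + t ∧ z ((x + t - (x - t)) / 2) < (x - t + (x + t)) / 2) := by
    intro x t ht hx
    refine ⟨by linarith, ?_⟩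
    rw [show (x + t - (x - t)) / 2 = t by ring, show (x - t + (x + t)) / 2 = x by ring]
    exact hx
  refine ⟨fun p => U (k p) (c p), fun p => V (k p) (c p), ⟨?_, ?_, ?_, ?_, ?_, ?_, ?_⟩⟩
  · intro p₀ hp₀
    refine ((hU (k p₀)).comp hcC).contDiffWithinAt.congr_of_eventuallyEq ?_ rfl
    filter_upwards [mem_nhdsWithin_of_mem_nhds (hloc p₀), self_mem_nhdsWithin] with p hp hp'
    exact (heqn _ p hp' (hp hp')).1
  · intro p₀ hp₀
    refine ((hV (k p₀)).comp hcC).contDiffWithinAt.congr_of_eventuallyEq ?_ rfl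
    filter_upwards [mem_nhdsWithin_of_mem_nhds (hloc p₀), self_mem_nhdsWithin] with p hp hp'
    exact (heqn _ p hp' (hp hp')).2
  · intro x t ht hx
    set n := k (x, t) with hn
    obtain ⟨-, e1, e2⟩ := hpart (hU n) ((hnear ht hx).mono fun p hp => hp.1)
    have h1 := (hs n).eqU _ _ (hk (x, t) ⟨ht.le, hx.le⟩) (hchar ht hx).1 (hchar ht hx).2
    have h2 : HasDerivAt (fun η => U n (x - t, η)) (fderiv ℝ (U n) (c (x, t)) (0, 1)) (x + t) :=
      ((hU n).differentiable one_ne_zero (c (x, t))).hasFDerivAt.comp_hasDerivAt (x + t)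
        ((hasDerivAt_const (x + t) (x - t)).prodMk (hasDerivAt_id (x + t)))
    have h3 := h2.unique h1
    have h4 : ((-1, 1) : ℝ × ℝ) + (1, 1) = (2 : ℝ) • (0, 1) := by ext <;> norm_num
    rw [e1, e2, ← map_add, h4, map_smul, h3, Complex.real_smul]
    simp only [charF, c]
    push_cast
    linear_combination ((m : ℂ) * V n (x - t, x + t)
      - N₁ α β (U n (x - t, x + t)) (V n (x - t, x + t))) * Complex.I_sq
  · intro x t ht hx
    set n := k (x, t) with hn
    obtain ⟨-, e1, e2⟩ := hpart (hV n) ((hnear ht hx).mono fun p hp => hp.2)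
    have h1 := (hs n).eqV _ _ (hk (x, t) ⟨ht.le, hx.le⟩) (hchar ht hx).1 (hchar ht hx).2
    have h2 : HasDerivAt (fun ξ => V n (ξ, x + t)) (fderiv ℝ (V n) (c (x, t)) (1, 0)) (x - t) :=
      ((hV n).differentiable one_ne_zero (c (x, t))).hasFDerivAt.comp_hasDerivAt (x - t)
        ((hasDerivAt_id (x - t)).prodMk (hasDerivAt_const (x - t) (x + t)))
    have h3 := h2.unique h1
    have h4 : ((-1, 1) : ℝ × ℝ) - (1, 1) = (-2 : ℝ) • (1, 0) := by ext <;> norm_num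
    rw [e1, e2, ← map_sub, h4, map_smul, h3, Complex.real_smul]
    simp only [charG, c]
    push_cast
    linear_combination ((m : ℂ) * U n (x - t, x + t)
      - N₂ α β (U n (x - t, x + t)) (V n (x - t, x + t))) * Complex.I_sq
  · intro x hx
    have h1 := hk (x, 0) (hinmem x hx)
    have := (hs (k (x, 0))).initial_u x ⟨hx, by simpa [c] using h1.2.2⟩
    simpa [c] using this
  · intro x hx
    have h1 := hk (x, 0) (hinmem x hx)
    have := (hs (k (x, 0))).initial_v x ⟨hx, by simpa [c] using h1.2.2⟩
    simpa [c] using this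
  · intro t ht
    refine (hs (k (z t, t))).boundary t ⟨ht, ?_⟩
    have := (hk (z t, t) (hbdmem t ht)).2.1
    have hN : (0 : ℝ) ≤ (k (z t, t) : ℝ) + 1 := by positivity
    -- The left limit `z N - N ≤ z t - t` of the region translates back into `t ≤ N`.
    exact (hanti.le_iff_ge (mem_Ici.2 hN) (mem_Ici.2 ht)).1 this

end Local

end DiracIBVP

/-! ### The global existence and uniqueness theorem -/

theorem theorem1 (m α β : ℝ) (hm : 0 ≤ m)
    (z : ℝ → ℝ) (hz : ContDiffOn ℝ 1 z (Set.Ici 0))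
    (lam : ℝ → ℂ) (hlam : ContDiffOn ℝ 1 lam (Set.Ici 0))
    -- (H1)
    (hz0 : z 0 = 0)
    (H1 : ∀ t : ℝ, 0 ≤ t → -1 < DiracIBVP.halfDeriv z t ∧ DiracIBVP.halfDeriv z t < 1)
    -- (H2)
    (H2 : ∀ t : ℝ, 0 ≤ t →
      ‖lam t‖ ^ 2 * (1 - DiracIBVP.halfDeriv z t) ≤ 1 + DiracIBVP.halfDeriv z t)
    -- the initial data
    (u₀ v₀ : ℝ → ℂ)
    (hu₀ : ContDiffOn ℝ 1 u₀ (Set.Ici 0)) (hv₀ : ContDiffOn ℝ 1 v₀ (Set.Ici 0))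
    (hu₀_supp : DiracIBVP.CompactSupportOnHalfLine u₀)
    (hv₀_supp : DiracIBVP.CompactSupportOnHalfLine v₀)
    -- the compatibility conditions at the corner
    (hcomp₀ : u₀ 0 = lam 0 * v₀ 0)
    (hcomp₁ :
      (1 - ((DiracIBVP.halfDeriv z 0 : ℝ) : ℂ)) * DiracIBVP.halfDeriv u₀ 0
        + lam 0 * (1 + ((DiracIBVP.halfDeriv z 0 : ℝ) : ℂ)) * DiracIBVP.halfDeriv v₀ 0
        + Complex.I * lam 0 * ((m : ℂ) * u₀ 0 - DiracIBVP.N₂ α β (u₀ 0) (v₀ 0))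
        - Complex.I * ((m : ℂ) * v₀ 0 - DiracIBVP.N₁ α β (u₀ 0) (v₀ 0))
        + DiracIBVP.halfDeriv lam 0 * v₀ 0 = 0) :
    (∃ u v : ℝ × ℝ → ℂ, DiracIBVP.IsGlobalC1Solution m α β z lam u₀ v₀ u v) ∧
    (∀ u v u' v' : ℝ × ℝ → ℂ,
      DiracIBVP.IsGlobalC1Solution m α β z lam u₀ v₀ u v →
      DiracIBVP.IsGlobalC1Solution m α β z lam u₀ v₀ u' v' →
      Set.EqOn u u' (DiracIBVP.region z) ∧ Set.EqOn v v' (DiracIBVP.region z)) := by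
  open DiracIBVP Set in
  have hanti := strictAntiOn_sub_id hz fun t ht => (H1 t ht).2
  have hmono := strictMonoOn_add_id hz fun t ht => (H1 t ht).1
  have hdata : ∀ N : ℝ, 0 < N → ∃ A μ a b, IsCharData z lam u₀ v₀ N A μ a b ∧
      (∀ ξ ∈ Icc (z N - N) 0, ‖μ ξ‖ ^ 2 ≤ -deriv A ξ) ∧
      CharCompatible (charF m α β fun _ => 1) (charG m α β fun _ => 1) A μ a b := fun N hN =>
    exists_isCharData hz hlam hz0 H1 H2 hu₀ hv₀ (by
      simp only [charF, charG]
      push_cast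
      linear_combination hcomp₁) hN
  have huniq : ∀ (N : ℝ), 0 < N → ∀ (U V U' V' : ℝ × ℝ → ℂ),
      IsLocalCharSolution m α β z lam u₀ v₀ N U V →
      IsLocalCharSolution m α β z lam u₀ v₀ N U' V' →
      EqOn U U' (charRegion z N) ∧ EqOn V V' (charRegion z N) := by
    intro N hN U V U' V' h h'
    obtain ⟨A, μ, a, b, hd, -, -⟩ := hdata N hN
    rw [← hd.charDomain_eq hanti hz0]
    exact eqOn_of_isCharSolution hd.boundary hd.contDiff_μ.continuous hd.contDiff_a.continuous
      hd.contDiff_b.continuous (h.isCharSolution hanti hmono hz0 hd)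
      (h'.isCharSolution hanti hmono hz0 hd)
  refine ⟨exists_isGlobalC1Solution_of_local hz.continuousOn hanti hmono hz0 (fun n => ?_)
    (fun n => huniq _ (by positivity)), fun u v u' v' h h' => ?_⟩
  · obtain ⟨A, μ, a, b, hd, hμA, hc⟩ := hdata (n + 1) (by positivity)
    have hN : (0 : ℝ) ≤ n + 1 := by positivity
    have h0 := hd.μ_curve 0 ⟨le_rfl, hN⟩
    rw [hz0, sub_zero] at h0
    have h00 : (0 : ℝ) ∈ Icc 0 (2 * ((n : ℝ) + 1) + z (n + 1)) := ⟨le_rfl, hd.boundary.nonneg⟩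
    obtain ⟨u, v, h⟩ := exists_isClassicalCharSolution hm hd.boundary hd.contDiff_A hd.contDiff_μ
      hd.contDiff_a hd.contDiff_b hμA (by rw [hd.a_eq 0 h00, hd.b_eq 0 h00, h0, hcomp₀]) hc
    exact ⟨_, _, h.contDiff_u, h.contDiff_v, h.isLocalCharSolution hanti hz0 hd⟩
  · have key : ∀ p ∈ region z, u p = u' p ∧ v p = v' p := by
      rintro ⟨x, t⟩ hp
      -- Any point lies in a characteristic region with this parameter, so uniqueness there decides
      -- uniqueness of the global solution.
      have hN : (0 : ℝ) < max t (x + t) + 1 := by linarith [le_max_left t (x + t), hp.1]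
      have hmem := mem_charRegion_of_le hanti hmono hz0 (N := max t (x + t) + 1) hp
        (by linarith [le_max_left t (x + t)]) (by linarith [le_max_right t (x + t)])
      have := huniq _ hN _ _ _ _ (h.isLocalCharSolution hz.continuousOn _)
        (h'.isLocalCharSolution hz.continuousOn _)
      have e : ((x - t + (x + t)) / 2, (x + t - (x - t)) / 2) = (x, t) := by
        ext <;> simp only <;> ring
      have e1 := this.1 hmem
      have e2 := this.2 hmem
      simp only [e] at e1 e2
      exact ⟨e1, e2⟩
    exact ⟨fun p hp => (key p hp).1, fun p hp => (key p hp).2⟩
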